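/- Consider a single-item inventory system reviewed in periods $t=0,1,\dots$ with nonnegative i.i.d. demands $D_0,D_1,\dots$ that are not almost surely constant, full backlogging, a regular supplier with integer lead time $l^r$ and unit price $0$, and an expedited supplier with integer lead time $0\le l^e<l^r$ and unit price (premium) $c^e>0$; put $l=l^r-l^e$. The system starts empty. An admissible policy chooses nonnegative orders $q^e_t$ and $q^r_t$ from the history available in period $t$ (before $D_t$ is observed). The net inventory level satisfies $I_t=I_{t-1}-D_{t-1}+q^e_{t-l^e}+q^r_{t-l^r}$, the cost of period $t$ is $C^\pi_t=c^e q^e_t+h(I_t-D_t)^++p(D_t-I_t)^+$ with $h,p>0$, and the long-run average cost of a policy $\pi$ is $C^\pi=\limsup_{T\to\infty}\frac1T\sum_{t=1}^T\mathbb E[C^\pi_t]$. Let $C^{\pi^*}(p,c^e)=\inf_\pi C^\pi$ be the optimal cost, and let $C^{\mathcal B^*}(p,h,l^r)$ be the optimal long-run average holding and backlog cost of the system with backlogging and only one supplier, with lead time $l^r$. Let $\tilde\Pi(p,c^e)$ be the set of admissible policies $\pi$ with $C^\pi(p,c^e)\le C^{\mathcal B^*}(p,h,l^r)$. Assume $c^e/p<l$,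 and assume that $X=D_0+\dots+D_{l^r}$ satisfies $0<\mathbb E[X]<\infty$ and is either bounded, or unbounded with $\lim_{d\to\infty}\mathbb E[X-d\mid X>d]/d=0$. Then $0<C^{\pi^*}(pn,c^en)<\infty$ for all real $n>0$, and: (a) if $\pi_n\in\tilde\Pi(pn,c^en)$ for all $n>0$, then $\lim_{n\to\infty}C^{\pi_n}(pn,c^en)/C^{\pi^*}(pn,c^en)=1$; (b) if $\mathcal P$ is a class of admissible policies with $\inf_{\pi\in\mathcal P}C^{\pi}(pn,c^en)\le C^{\mathcal B^*}(pn,h,l^r)$ for all $n>0$, then $\lim_{n\to\infty}\inf_{\pi\in\mathcal P}C^{\pi}(pn,c^en)/C^{\pi^*}(pn,c^en)=1$; (c) the hypothesis of (b), and hence its conclusion, holds for each of the following classes, with parameters $S^e,S^r\in\mathbb R$. Let $IP^e_t$ be the net inventory plus all outstanding expedited orders plus the outstanding regular orders that arrive by period $t+l^e$, and let $IP^r_t$ be the net inventory plus all outstanding orders, both before ordering in period $t$. Dual-index (DI): $q^e_t=(S^e-IP^e_t)^+$, $q^r_t=(S^r-IP^r_t-q^e_t)^+$. Capped dual-index (CDI):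 the same $q^e_t$, and $q^r_t=\min\{(S^r-IP^r_t-q^e_t)^+,\bar q\}$ with a further parameter $\bar q\in[0,\infty]$. Single-index (SI): $q^e_t=(S^e-IP^r_t)^+$, $q^r_t=(S^r-IP^r_t-q^e_t)^+$. -/

import Mathlib

open Filter Topology MeasureTheory ProbabilityTheory
open scoped ENNReal

noncomputable section

namespace DualSourcing

/-- An admissible policy for the dual-sourcing system.  The orders of period `t` are determined by
the history available in period `t`.  All systems start empty, so past inventory levels and past
orders are themselves functions of the demands of the periods `0, …, t - 1`, and the order sizes are
nonnegative measurable functions of these demands. -/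
structure Policy where
  expedited : (t : ℕ) → (Fin t → ℝ) → ℝ
  regular : (t : ℕ) → (Fin t → ℝ) → ℝ
  expedited_nonneg : ∀ t x, 0 ≤ expedited t x
  regular_nonneg : ∀ t x, 0 ≤ regular t x
  measurable_expedited : ∀ t, Measurable (expedited t)
  measurable_regular : ∀ t, Measurable (regular t)

/-- An admissible policy for an inventory system with a single supplier. -/
structure SinglePolicy where
  order : (t : ℕ) → (Fin t → ℝ) → ℝ
  order_nonneg : ∀ t x, 0 ≤ order t x
  measurable_order : ∀ t, Measurable (order t)

/-- The expedited order placed in period `t` along the demand path `d`. -/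
def Policy.qe (π : Policy) (d : ℕ → ℝ) (t : ℕ) : ℝ := π.expedited t (fun i => d i)

/-- The regular order placed in period `t` along the demand path `d`. -/
def Policy.qr (π : Policy) (d : ℕ → ℝ) (t : ℕ) : ℝ := π.regular t (fun i => d i)

/-- The order placed in period `t` along the demand path `d`. -/
def SinglePolicy.q (σ : SinglePolicy) (d : ℕ → ℝ) (t : ℕ) : ℝ := σ.order t (fun i => d i)

/-- The quantity that arrives in period `t` if `q s` is ordered in each period `s ≥ 0`, with lead
time `L` (nothing was ordered before period `0`). -/
def arrival (q : ℕ → ℝ) (L t : ℕ) : ℝ := if L ≤ t then q (t - L) else 0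

/-- Net inventory level in period `t`, after arrivals and before demand, when `a s` arrives in
period `s` and the demand of period `s` is `d s`; the system starts empty. -/
def netInventory (a d : ℕ → ℝ) : ℕ → ℝ
  | 0 => a 0
  | t + 1 => netInventory a d t - d t + a (t + 1)

/-- The net inventory level `I_t` of the dual-sourcing system. -/
def Policy.inv (π : Policy) (le lr : ℕ) (d : ℕ → ℝ) (t : ℕ) : ℝ :=
  netInventory (fun s => arrival (π.qe d) le s + arrival (π.qr d) lr s) d t

/-- The net inventory level `I_t` of the single-supplier backlog system with lead time `L`. -/
def SinglePolicy.inv (σ : SinglePolicy) (L : ℕ) (d : ℕ → ℝ) (t : ℕ) : ℝ :=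
  netInventory (arrival (σ.q d) L) d t

/-- The net inventory level that is seen when the expedited order of period `t` is decided.  It is
`I_t`, except that for `le = 0` the order of period `t` itself, which arrives at once, is not yet
there. -/
def Policy.invReview (π : Policy) (le lr : ℕ) (d : ℕ → ℝ) (t : ℕ) : ℝ :=
  π.inv le lr d t - (if le = 0 then π.qe d t else 0)

/-- The expedited inventory position before ordering in period `t`: the net inventory, the
outstanding expedited orders, and those outstanding regular orders that arrive no later than
period `t + le`. -/
def Policy.expeditedPosition (π : Policy) (le lr : ℕ) (d : ℕ → ℝ) (t : ℕ) : ℝ :=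
  π.invReview le lr d t
    + ∑ i ∈ (Finset.range t).filter (fun i => t < i + le), π.qe d i
    + ∑ i ∈ (Finset.range t).filter (fun i => t < i + lr ∧ i + lr ≤ t + le), π.qr d i

/-- The regular inventory position before ordering in period `t`: the net inventory and all
outstanding orders. -/
def Policy.regularPosition (π : Policy) (le lr : ℕ) (d : ℕ → ℝ) (t : ℕ) : ℝ :=
  π.invReview le lr d t
    + ∑ i ∈ (Finset.range t).filter (fun i => t < i + le), π.qe d i
    + ∑ i ∈ (Finset.range t).filter (fun i => t < i + lr), π.qr d i

/-- Dual-index policies: the expedited order raises the expedited inventory position to `Se`, and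
then the regular order raises the regular inventory position (which includes the expedited order
just placed) to `Sr`. -/
def dualIndex (le lr : ℕ) : Set Policy :=
  {π | ∃ Se Sr : ℝ, ∀ (d : ℕ → ℝ) (t : ℕ),
    π.qe d t = max (Se - π.expeditedPosition le lr d t) 0 ∧
    π.qr d t = max (Sr - (π.regularPosition le lr d t + π.qe d t)) 0}

/-- Capped dual-index policies: as the dual-index policies, with regular orders capped at
`cap ∈ [0, ∞]`. -/
def cappedDualIndex (le lr : ℕ) : Set Policy :=
  {π | ∃ (Se Sr : ℝ) (cap : ℝ≥0∞), ∀ (d : ℕ → ℝ) (t : ℕ),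
    π.qe d t = max (Se - π.expeditedPosition le lr d t) 0 ∧
    ENNReal.ofReal (π.qr d t) =
      min (ENNReal.ofReal (Sr - (π.regularPosition le lr d t + π.qe d t))) cap}

/-- Single-index policies: order-up-to rules for both suppliers, based on the regular inventory
position only. -/
def singleIndex (le lr : ℕ) : Set Policy :=
  {π | ∃ Se Sr : ℝ, ∀ (d : ℕ → ℝ) (t : ℕ),
    π.qe d t = max (Se - π.regularPosition le lr d t) 0 ∧
    π.qr d t = max (Sr - (π.regularPosition le lr d t + π.qe d t)) 0}

/-- The cost of period `t` in the dual-sourcing system along the demand path `d`; the unit price of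
the regular supplier is normalized to `0`, so that `ce` is the expedited premium. -/
def Policy.periodCost (π : Policy) (le lr : ℕ) (h p ce : ℝ) (d : ℕ → ℝ) (t : ℕ) : ℝ :=
  ce * π.qe d t + h * max (π.inv le lr d t - d t) 0 + p * max (d t - π.inv le lr d t) 0

/-- The cost of period `t` in the single-supplier backlog system along the demand path `d`. -/
def SinglePolicy.periodCost (σ : SinglePolicy) (L : ℕ) (h p : ℝ) (d : ℕ → ℝ) (t : ℕ) : ℝ :=
  h * max (σ.inv L d t - d t) 0 + p * max (d t - σ.inv L d t) 0

variable {Ω : Type*} [MeasurableSpace Ω]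

/-- The long-run average `limsup_T (1/T) ∑_{t=1}^T E[C_t]` of nonnegative random costs. -/
def longRunAverage (μ : Measure Ω) (C : ℕ → Ω → ℝ) : ℝ≥0∞ :=
  limsup (fun T : ℕ => (∑ t ∈ Finset.Icc 1 T, ∫⁻ ω, ENNReal.ofReal (C t ω) ∂μ) / (T : ℝ≥0∞)) atTop

/-- The long-run average cost `C^π(p, h, ce, lr, le)` of a policy, for the demand process `D`. -/
def Policy.cost (π : Policy) (μ : Measure Ω) (D : ℕ → Ω → ℝ) (le lr : ℕ) (h p ce : ℝ) : ℝ≥0∞ :=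
  longRunAverage μ (fun t ω => π.periodCost le lr h p ce (fun s => D s ω) t)

/-- The long-run average cost of a policy in the single-supplier backlog system. -/
def SinglePolicy.cost (σ : SinglePolicy) (μ : Measure Ω) (D : ℕ → Ω → ℝ) (L : ℕ) (h p : ℝ) : ℝ≥0∞ :=
  longRunAverage μ (fun t ω => σ.periodCost L h p (fun s => D s ω) t)

/-- The best long-run average cost within a class of policies. -/
def bestCost (P : Set Policy) (μ : Measure Ω) (D : ℕ → Ω → ℝ) (le lr : ℕ) (h p ce : ℝ) : ℝ≥0∞ :=
  ⨅ π ∈ P, π.cost μ D le lr h p ce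

/-- The optimal long-run average cost over all admissible dual-sourcing policies. -/
def optimalCost (μ : Measure Ω) (D : ℕ → Ω → ℝ) (le lr : ℕ) (h p ce : ℝ) : ℝ≥0∞ :=
  ⨅ π : Policy, π.cost μ D le lr h p ce

/-- The optimal long-run average cost of the single-supplier backlog system with lead time `L`. -/
def backlogOptimalCost (μ : Measure Ω) (D : ℕ → Ω → ℝ) (L : ℕ) (h p : ℝ) : ℝ≥0∞ :=
  ⨅ σ : SinglePolicy, σ.cost μ D L h p

/-- The policies that cost no more than optimal single sourcing from the regular supplier. -/
def noWorseThanSingleSourcing (μ : Measure Ω) (D : ℕ → Ω → ℝ) (le lr : ℕ) (h p ce : ℝ) :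
    Set Policy :=
  {π | π.cost μ D le lr h p ce ≤ backlogOptimalCost μ D lr h p}

/-- The cumulative demand of `n` periods. -/
def cumulativeDemand (D : ℕ → Ω → ℝ) (n : ℕ) (ω : Ω) : ℝ := ∑ i ∈ Finset.range n, D i ω

/-- `X` has a positive and finite mean, and it is either (essentially) bounded, or unbounded with
`E[X - d | X > d] / d → 0` as `d → ∞`. -/
def TailAssumption (μ : Measure Ω) (X : Ω → ℝ) : Prop :=
  (Integrable X μ ∧ 0 < ∫ ω, X ω ∂μ) ∧
  ((∃ M : ℝ, ∀ᵐ ω ∂μ, X ω ≤ M) ∨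
    ((¬ ∃ M : ℝ, ∀ᵐ ω ∂μ, X ω ≤ M) ∧
      Tendsto (fun d : ℝ => (∫ ω, (X ω - d) ∂(cond μ {ω | d < X ω})) / d) atTop (𝓝 0)))

end DualSourcing

end

/-!
Both the cost of single sourcing and a lower bound for all dual-sourcing policies are values of a
newsvendor problem, and these values differ only in the shortage cost.

Let `X` be the demand of `lr + 1` periods, and let `N(p)` be the least expected cost
`E[h (y - X)⁺ + p (X - y)⁺]` of a stock `y` (`newsvendorValue`). The net inventory after the demand
of period `s + lr` is `y + e - X`, where `y` is the inventory position after ordering in period `s`,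
`e` is the sum of the expedited orders of the `lr - le` periods that follow, and the demand `X` of
the periods `s, …, s + lr` is independent of `y` (`Policy.inv_sub_demand`). As each expedited order
is counted in `lr - le` such sums, the premium pays `c = ce / (lr - le)` per unit of `e`. Since
`c ≤ p`, using `e` to avoid shortages is no cheaper than being short at the rate `c`, so every policy
costs at least `N(c)` (`Policy.newsvendorValue_le_cost`). Without expedited orders the same identity
shows that the optimal single-sourcing cost is `N(p)`: the lower bound is
`newsvendorValue_le_backlogOptimalCost`, and base-stock policies attain it. Index policies with
`Se → -∞` keep the inventory position fixed while their expedited orders vanish, so they approach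
`N(p)` as well (`bestCost_le_newsvendorValue`).

With both prices scaled by `n`, all ratios in question lie between `1` and `N(p n) / N(c n)`, and
this tends to `1` (`newsvendorValue_eventually_le`). For bounded `X` the value `N` is bounded and
nondecreasing. For unbounded `X`, let `y` be the upper `h / (h + c n)`-quantile, which is optimal for
`c n`. Raising the shortage cost to `p n` adds `(p - c) n E[(X - y)⁺]`, which is at most a multiple
of `E[X - y | X > y] = o(y)`, whereas `N(c n) ≥ h (y - E[X])`.
-/

noncomputable section

namespace DualSourcing

/-! ### The newsvendor problem -/

/-- The cost of facing the demand `x` with the stock `y`: `h` per unit left over, `p` per unit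
short. -/
def newsvendorLoss (h p y x : ℝ) : ℝ := h * max (y - x) 0 + p * max (x - y) 0

theorem newsvendorLoss_nonneg {h p : ℝ} (hh : 0 ≤ h) (hp : 0 ≤ p) (y x : ℝ) :
    0 ≤ newsvendorLoss h p y x :=
  add_nonneg (mul_nonneg hh (le_max_right _ _)) (mul_nonneg hp (le_max_right _ _))

theorem measurable_newsvendorLoss {α : Type*} [MeasurableSpace α] {h p : ℝ} {f g : α → ℝ}
    (hf : Measurable f) (hg : Measurable g) :
    Measurable fun a => newsvendorLoss h p (f a) (g a) := by
  unfold newsvendorLoss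
  fun_prop

theorem newsvendorLoss_mono {h p p' : ℝ} (hpp : p ≤ p') (y x : ℝ) :
    newsvendorLoss h p y x ≤ newsvendorLoss h p' y x :=
  add_le_add le_rfl (mul_le_mul_of_nonneg_right hpp (le_max_right _ _))

/-- The subgradient inequality at `y` for the subgradient that is `h` on `{x ≤ y}`. -/
theorem newsvendorLoss_ge_of_le {h p y z : ℝ} (hh : 0 ≤ h) (hp : 0 ≤ p) (hyz : y ≤ z) (x : ℝ) :
    newsvendorLoss h p y x + (z - y) * (h - (h + p) * (Set.Ioi y).indicator 1 x) ≤
      newsvendorLoss h p z x := by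
  unfold newsvendorLoss
  by_cases hx : y < x
  · rw [Set.indicator_of_mem (by exact hx), max_eq_right (by linarith : y - x ≤ 0),
      max_eq_left (by linarith : 0 ≤ x - y)]
    have h1 := mul_nonneg hh (le_max_right (z - x) 0)
    have h2 := mul_le_mul_of_nonneg_left (le_max_left (x - z) 0) hp
    simp only [Pi.one_apply]
    linarith
  · rw [not_lt] at hx
    rw [Set.indicator_of_notMem (by simpa using hx), max_eq_left (by linarith : 0 ≤ y - x),
      max_eq_right (by linarith : x - y ≤ 0), max_eq_left (by linarith : 0 ≤ z - x),
      max_eq_right (by linarith : x - z ≤ 0)]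
    linarith

/-- The subgradient inequality at `y` for the subgradient that is `-p` on `{y ≤ x}`. -/
theorem newsvendorLoss_ge_of_ge {h p y z : ℝ} (hh : 0 ≤ h) (hp : 0 ≤ p) (hzy : z ≤ y) (x : ℝ) :
    newsvendorLoss h p y x + (y - z) * ((h + p) * (Set.Ici y).indicator 1 x - h) ≤
      newsvendorLoss h p z x := by
  unfold newsvendorLoss
  by_cases hx : y ≤ x
  · rw [Set.indicator_of_mem (by exact hx), max_eq_right (by linarith : y - x ≤ 0),
      max_eq_left (by linarith : 0 ≤ x - y), max_eq_right (by linarith : z - x ≤ 0),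
      max_eq_left (by linarith : 0 ≤ x - z)]
    simp only [Pi.one_apply]
    linarith
  · rw [not_le] at hx
    rw [Set.indicator_of_notMem (by simpa using hx), max_eq_left (by linarith : 0 ≤ y - x),
      max_eq_right (by linarith : x - y ≤ 0)]
    have h1 := mul_nonneg hp (le_max_right (x - z) 0)
    have h2 := mul_le_mul_of_nonneg_left (le_max_left (z - x) 0) hh
    linarith

section Newsvendor

variable {Ω : Type*} [MeasurableSpace Ω] {μ : Measure Ω} {X : Ω → ℝ} {h p y : ℝ}

/-- The expected newsvendor cost of the stock `y` for the random demand `X`. -/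
def newsvendorCost (μ : Measure Ω) (X : Ω → ℝ) (h p y : ℝ) : ℝ≥0∞ :=
  ∫⁻ ω, ENNReal.ofReal (newsvendorLoss h p y (X ω)) ∂μ

/-- The optimal expected newsvendor cost for the random demand `X`. -/
def newsvendorValue (μ : Measure Ω) (X : Ω → ℝ) (h p : ℝ) : ℝ≥0∞ :=
  ⨅ y, newsvendorCost μ X h p y

theorem newsvendorCost_mono {p' : ℝ} (hpp : p ≤ p') (y : ℝ) :
    newsvendorCost μ X h p y ≤ newsvendorCost μ X h p' y :=
  lintegral_mono fun _ => ENNReal.ofReal_le_ofReal (newsvendorLoss_mono hpp _ _)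

theorem newsvendorValue_mono {p' : ℝ} (hpp : p ≤ p') :
    newsvendorValue μ X h p ≤ newsvendorValue μ X h p' :=
  iInf_mono fun y => newsvendorCost_mono hpp y

theorem integrable_newsvendorLoss [IsFiniteMeasure μ] (hX : Integrable X μ) (h p y : ℝ) :
    Integrable (fun ω => newsvendorLoss h p y (X ω)) μ :=
  ((((integrable_const y).sub hX).pos_part).const_mul h).add
    (((hX.sub (integrable_const y)).pos_part).const_mul p)

theorem newsvendorCost_eq_ofReal [IsFiniteMeasure μ] (hX : Integrable X μ) (hh : 0 ≤ h)
    (hp : 0 ≤ p) (y : ℝ) :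
    newsvendorCost μ X h p y = ENNReal.ofReal (∫ ω, newsvendorLoss h p y (X ω) ∂μ) :=
  (ofReal_integral_eq_lintegral_ofReal (integrable_newsvendorLoss hX h p y)
    (ae_of_all _ fun _ => newsvendorLoss_nonneg hh hp _ _)).symm

theorem newsvendorValue_lt_top [IsFiniteMeasure μ] (hX : Integrable X μ) (hh : 0 ≤ h)
    (hp : 0 ≤ p) : newsvendorValue μ X h p < ⊤ :=
  (iInf_le _ 0).trans_lt (by rw [newsvendorCost_eq_ofReal hX hh hp]; simp)

/-- For nonnegative demand, a negative stock is no better than an empty one. -/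
theorem newsvendorCost_zero_le (hX0 : ∀ᵐ ω ∂μ, 0 ≤ X ω) (hh : 0 ≤ h) (hp : 0 ≤ p)
    (hy : y ≤ 0) : newsvendorCost μ X h p 0 ≤ newsvendorCost μ X h p y := by
  refine lintegral_mono_ae ?_
  filter_upwards [hX0] with ω hω
  refine ENNReal.ofReal_le_ofReal ?_
  unfold newsvendorLoss
  rw [max_eq_right (by linarith : 0 - X ω ≤ 0)]
  have h1 := mul_nonneg hh (le_max_right (y - X ω) 0)
  have h2 : p * max (X ω - 0) 0 ≤ p * max (X ω - y) 0 := by gcongr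
  linarith

/-- A nonnegative random variable has an upper `τ`-quantile. -/
theorem exists_quantile [IsProbabilityMeasure μ] (hX : Measurable X)
    (hX0 : ∀ᵐ ω ∂μ, 0 ≤ X ω) {τ : ℝ} (hτ0 : 0 < τ) (hτ1 : τ < 1) :
    ∃ y, μ.real {ω | y < X ω} ≤ τ ∧ τ ≤ μ.real {ω | y ≤ X ω} := by
  set F : ℝ → ℝ := fun y => μ.real {ω | y < X ω} with hF
  have hFmeas : ∀ y, MeasurableSet {ω | y < X ω} := fun y => measurableSet_lt measurable_const hX
  have hanti : Antitone F := fun a b hab => measureReal_mono fun ω hω => lt_of_le_of_lt hab hω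
  have hlim : Tendsto (fun n : ℕ => F n) atTop (𝓝 0) := by
    have := tendsto_measure_iInter_atTop (μ := μ) (s := fun n : ℕ => {ω | (n : ℝ) < X ω})
      (fun n => (hFmeas n).nullMeasurableSet)
      (fun a b hab ω hω => lt_of_le_of_lt (by exact_mod_cast hab : (a : ℝ) ≤ b) hω)
      ⟨0, measure_ne_top _ _⟩
    have he : (⋂ n : ℕ, {ω | (n : ℝ) < X ω}) = ∅ := by
      ext ω
      obtain ⟨n, hn⟩ := exists_nat_gt (X ω)
      simp only [Set.mem_iInter, Set.mem_ofPred_eq, Set.mem_empty_iff_false, iff_false, not_forall]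
      exact ⟨n, by linarith⟩
    rw [he, measure_empty] at this
    simpa [hF, Measure.real, Function.comp_def] using
      (ENNReal.tendsto_toReal ENNReal.zero_ne_top).comp this
  set S : Set ℝ := {y | F y ≤ τ} with hS
  have hne : S.Nonempty := by
    obtain ⟨n, hn⟩ := (hlim.eventually (gt_mem_nhds hτ0)).exists
    exact ⟨n, hn.le⟩
  have hbdd : BddBelow S := by
    refine ⟨0, fun y hy => ?_⟩
    by_contra! hy0
    have : F y = 1 := by
      have : μ {ω | y < X ω} = 1 := by
        rw [prob_compl_eq_zero_iff (hFmeas y) |>.symm]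
        filter_upwards [hX0] with ω hω
        simpa using hy0.trans_le hω
      simp [hF, Measure.real, this]
    have hy' : F y ≤ τ := hy
    linarith
  refine ⟨sInf S, ?_, ?_⟩
  · have hU : (⋃ n : ℕ, {ω | sInf S + 1 / ((n : ℝ) + 1) < X ω}) = {ω | sInf S < X ω} := by
      ext ω
      simp only [Set.mem_iUnion, Set.mem_ofPred_eq]
      constructor
      · rintro ⟨n, hn⟩
        have : (0 : ℝ) < 1 / ((n : ℝ) + 1) := by positivity
        linarith
      · intro hω
        obtain ⟨n, hn⟩ := exists_nat_one_div_lt (sub_pos.2 hω)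
        exact ⟨n, by linarith⟩
    have ht := tendsto_measure_iUnion_atTop (μ := μ)
      (s := fun n : ℕ => {ω | sInf S + 1 / ((n : ℝ) + 1) < X ω}) (fun a b hab ω hω => by
        have : (1 : ℝ) / ((b : ℝ) + 1) ≤ 1 / ((a : ℝ) + 1) :=
          Nat.one_div_le_one_div hab
        simp only [Set.mem_ofPred_eq] at hω ⊢
        linarith)
    rw [hU] at ht
    refine le_of_tendsto ((ENNReal.tendsto_toReal (measure_ne_top _ _)).comp ht)
      (Eventually.of_forall fun n => ?_)
    have hpos : (0 : ℝ) < 1 / ((n : ℝ) + 1) := by positivity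
    obtain ⟨z, hz, hzlt⟩ := exists_lt_of_csInf_lt hne (lt_add_of_pos_right (sInf S) hpos)
    exact (hanti hzlt.le).trans hz
  · have hI : (⋂ n : ℕ, {ω | sInf S - 1 / ((n : ℝ) + 1) < X ω}) = {ω | sInf S ≤ X ω} := by
      ext ω
      simp only [Set.mem_iInter, Set.mem_ofPred_eq]
      constructor
      · intro hω
        by_contra! hlt
        obtain ⟨n, hn⟩ := exists_nat_one_div_lt (sub_pos.2 hlt)
        have := hω n
        linarith
      · intro hω n
        have : (0 : ℝ) < 1 / ((n : ℝ) + 1) := by positivity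
        linarith
    have ht := tendsto_measure_iInter_atTop (μ := μ)
      (s := fun n : ℕ => {ω | sInf S - 1 / ((n : ℝ) + 1) < X ω})
      (fun n => (hFmeas _).nullMeasurableSet) (fun a b hab ω hω => by
        have : (1 : ℝ) / ((b : ℝ) + 1) ≤ 1 / ((a : ℝ) + 1) :=
          Nat.one_div_le_one_div hab
        simp only [Set.mem_ofPred_eq] at hω ⊢
        linarith) ⟨0, measure_ne_top _ _⟩
    rw [hI] at ht
    refine ge_of_tendsto ((ENNReal.tendsto_toReal (measure_ne_top _ _)).comp ht)
      (Eventually.of_forall fun n => ?_)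
    have hpos : (0 : ℝ) < 1 / ((n : ℝ) + 1) := by positivity
    have : sInf S - 1 / ((n : ℝ) + 1) ∉ S := fun hmem => by
      have := csInf_le hbdd hmem
      linarith
    exact (not_le.1 this).le

/-- The upper `h / (h + p)`-quantile is an optimal stock, by the subgradient inequalities. -/
theorem newsvendorCost_le_of_quantile [IsProbabilityMeasure μ] (hX : Measurable X)
    (hXi : Integrable X μ) (hh : 0 < h) (hp : 0 < p)
    (h1 : μ.real {ω | y < X ω} ≤ h / (h + p)) (h2 : h / (h + p) ≤ μ.real {ω | y ≤ X ω}) (z : ℝ) :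
    newsvendorCost μ X h p y ≤ newsvendorCost μ X h p z := by
  rw [newsvendorCost_eq_ofReal hXi hh.le hp.le, newsvendorCost_eq_ofReal hXi hh.le hp.le]
  refine ENNReal.ofReal_le_ofReal ?_
  have hsum : 0 < h + p := by positivity
  have hint : ∀ s : Set ℝ, MeasurableSet s →
      Integrable (fun ω => s.indicator (1 : ℝ → ℝ) (X ω)) μ ∧
      ∫ ω, s.indicator (1 : ℝ → ℝ) (X ω) ∂μ = μ.real (X ⁻¹' s) := by
    intro s hs
    have : (fun ω => s.indicator (1 : ℝ → ℝ) (X ω)) = (X ⁻¹' s).indicator 1 := rfl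
    rw [this]
    exact ⟨(integrable_const (1 : ℝ)).indicator (hX hs), integral_indicator_one (hX hs)⟩
  have hL := fun y => integrable_newsvendorLoss hXi h p y
  rcases le_total y z with hyz | hzy
  · obtain ⟨hi, he⟩ := hint (Set.Ioi y) measurableSet_Ioi
    have hi' : Integrable (fun ω => (z - y) *
        (h - (h + p) * (Set.Ioi y).indicator (1 : ℝ → ℝ) (X ω))) μ :=
      ((integrable_const h).sub (hi.const_mul _)).const_mul _
    have := integral_mono ((hL y).add hi') (hL z)
      fun ω => newsvendorLoss_ge_of_le hh.le hp.le hyz (X ω)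
    simp only [Pi.add_apply] at this
    rw [integral_add (hL y) hi', integral_const_mul,
      integral_sub (integrable_const h) (hi.const_mul _), integral_const_mul, he] at this
    simp only [integral_const, probReal_univ, one_smul] at this
    have h3 : (h + p) * μ.real (X ⁻¹' Set.Ioi y) ≤ h := by
      rw [mul_comm]; exact (le_div_iff₀ hsum).1 h1
    have := mul_nonneg (sub_nonneg.2 hyz) (sub_nonneg.2 h3)
    linarith
  · obtain ⟨hi, he⟩ := hint (Set.Ici y) measurableSet_Ici
    have hi' : Integrable (fun ω => (y - z) *
        ((h + p) * (Set.Ici y).indicator (1 : ℝ → ℝ) (X ω) - h)) μ :=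
      ((hi.const_mul _).sub (integrable_const h)).const_mul _
    have := integral_mono ((hL y).add hi') (hL z)
      fun ω => newsvendorLoss_ge_of_ge hh.le hp.le hzy (X ω)
    simp only [Pi.add_apply] at this
    rw [integral_add (hL y) hi', integral_const_mul,
      integral_sub (hi.const_mul _) (integrable_const h), integral_const_mul, he] at this
    simp only [integral_const, probReal_univ, one_smul] at this
    have h3 : h ≤ (h + p) * μ.real (X ⁻¹' Set.Ici y) := by
      rw [mul_comm]; exact (div_le_iff₀ hsum).1 h2
    have := mul_nonneg (sub_nonneg.2 hzy) (sub_nonneg.2 h3)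
    linarith

/-- For a demand that is not almost surely constant, every stock has a mismatch cost, and this cost
is bounded away from zero: the distance of `X` to its mean is at most twice its distance to any
other stock. -/
theorem newsvendorValue_pos [IsProbabilityMeasure μ] (hXi : Integrable X μ) (hh : 0 < h)
    (hp : 0 < p) (hne : ¬ ∀ᵐ ω ∂μ, X ω = ∫ ω', X ω' ∂μ) : 0 < newsvendorValue μ X h p := by
  set m := ∫ ω', X ω' ∂μ with hm
  have hdev : 0 < ∫ ω, |X ω - m| ∂μ := by
    refine lt_of_le_of_ne (integral_nonneg fun _ => abs_nonneg _) fun h0 => hne ?_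
    have := (integral_eq_zero_iff_of_nonneg (fun ω => abs_nonneg (X ω - m))
      (hXi.sub (integrable_const m)).abs).1 h0.symm
    filter_upwards [this] with ω hω
    simpa [sub_eq_zero] using hω
  have hc : 0 < min h p := lt_min hh hp
  refine lt_of_lt_of_le (ENNReal.ofReal_pos.2
    (by positivity : 0 < min h p * (∫ ω, |X ω - m| ∂μ) / 2)) (le_iInf fun y => ?_)
  rw [newsvendorCost_eq_ofReal hXi hh.le hp.le]
  refine ENNReal.ofReal_le_ofReal ?_
  have hiy : Integrable (fun ω => |X ω - y|) μ := (hXi.sub (integrable_const y)).abs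
  have h1 : min h p * ∫ ω, |X ω - y| ∂μ ≤ ∫ ω, newsvendorLoss h p y (X ω) ∂μ := by
    rw [← integral_const_mul]
    refine integral_mono (hiy.const_mul _) (integrable_newsvendorLoss hXi h p y) fun ω => ?_
    unfold newsvendorLoss
    rcases le_total y (X ω) with hy | hy
    · have := mul_le_mul_of_nonneg_right (min_le_right h p) (sub_nonneg.2 hy)
      simp only [abs_of_nonneg (sub_nonneg.2 hy), max_eq_left (sub_nonneg.2 hy),
        max_eq_right (sub_nonpos.2 hy)]
      linarith
    · have := mul_le_mul_of_nonneg_right (min_le_left h p) (sub_nonneg.2 hy)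
      simp only [abs_of_nonpos (sub_nonpos.2 hy), max_eq_left (sub_nonneg.2 hy),
        max_eq_right (sub_nonpos.2 hy)]
      linarith
  have h2 : |m - y| ≤ ∫ ω, |X ω - y| ∂μ := by
    have : m - y = ∫ ω, (X ω - y) ∂μ := by
      rw [integral_sub hXi (integrable_const y)]; simp [hm]
    rw [this]
    exact abs_integral_le_integral_abs
  have h3 : ∫ ω, |X ω - m| ∂μ ≤ (∫ ω, |X ω - y| ∂μ) + |m - y| := by
    have : ∫ ω, |X ω - m| ∂μ ≤ ∫ ω, (|X ω - y| + |m - y|) ∂μ :=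
      integral_mono (hXi.sub (integrable_const m)).abs (hiy.add (integrable_const _)) fun ω => by
        simpa [abs_sub_comm m y] using abs_sub_le (X ω) y m
    rw [integral_add hiy (integrable_const _)] at this
    simpa using this
  have h4 : min h p * (∫ ω, |X ω - m| ∂μ) ≤ min h p * (2 * ∫ ω, |X ω - y| ∂μ) :=
    mul_le_mul_of_nonneg_left (by linarith) hc.le
  linarith

end Newsvendor

/-! ### Insensitivity of the newsvendor value to the shortage cost -/

section Asymptotics

variable {Ω : Type*} [MeasurableSpace Ω] {μ : Measure Ω} {X : Ω → ℝ} {h : ℝ}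

/-- For bounded demand the newsvendor value is bounded in the shortage cost, hence convergent. -/
theorem newsvendorValue_le_of_bounded [IsProbabilityMeasure μ] (hX0 : ∀ᵐ ω ∂μ, 0 ≤ X ω)
    (hh : 0 < h) (hpos : 0 < newsvendorValue μ X h 1) {M : ℝ} (hM : ∀ᵐ ω ∂μ, X ω ≤ M)
    {a b ε : ℝ} (ha : 0 < a) (hε : 0 < ε) :
    ∀ᶠ n : ℝ in atTop, newsvendorValue μ X h (b * n) ≤
      ENNReal.ofReal (1 + ε) * newsvendorValue μ X h (a * n) := by
  set V : ℝ≥0∞ := ⨆ p, newsvendorValue μ X h p with hV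
  have hVtop : V ≠ ⊤ := by
    refine ne_top_of_le_ne_top (ENNReal.ofReal_ne_top (r := h * |M|)) (iSup_le fun p => ?_)
    refine (iInf_le _ M).trans ?_
    calc newsvendorCost μ X h p M ≤ ∫⁻ _, ENNReal.ofReal (h * |M|) ∂μ := by
          refine lintegral_mono_ae ?_
          filter_upwards [hX0, hM] with ω h0 h1
          refine ENNReal.ofReal_le_ofReal ?_
          unfold newsvendorLoss
          rw [max_eq_right (by linarith : X ω - M ≤ 0), max_eq_left (by linarith : 0 ≤ M - X ω)]
          nlinarith [le_abs_self M]
      _ = ENNReal.ofReal (h * |M|) := by simp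
  have hV0 : V ≠ 0 := (hpos.trans_le (le_iSup (newsvendorValue μ X h) 1)).ne'
  have hc1 : (1 : ℝ≥0∞) < ENNReal.ofReal (1 + ε) := by
    rw [← ENNReal.ofReal_one]
    exact (ENNReal.ofReal_lt_ofReal_iff (by linarith)).2 (by linarith)
  have hlt : V / ENNReal.ofReal (1 + ε) < V := by
    refine ENNReal.div_lt_of_lt_mul ?_
    calc V = V * 1 := (mul_one V).symm
      _ < V * ENNReal.ofReal (1 + ε) := (ENNReal.mul_lt_mul_iff_right hV0 hVtop).2 hc1
  obtain ⟨p₀, hp₀⟩ := lt_iSup_iff.1 hlt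
  filter_upwards [eventually_ge_atTop (p₀ / a)] with n hn
  have han : p₀ ≤ a * n := by rw [mul_comm]; exact (div_le_iff₀ ha).1 hn
  calc newsvendorValue μ X h (b * n) ≤ V := le_iSup (newsvendorValue μ X h) _
    _ ≤ newsvendorValue μ X h p₀ * ENNReal.ofReal (1 + ε) :=
        (ENNReal.div_le_iff_le_mul (Or.inl (by positivity)) (Or.inl ENNReal.ofReal_ne_top)).1 hp₀.le
    _ ≤ ENNReal.ofReal (1 + ε) * newsvendorValue μ X h (a * n) := by
        rw [mul_comm]
        gcongr
        exact newsvendorValue_mono han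

/-- The expected shortage is the shortage probability times the mean excess. -/
theorem integral_max_sub_zero [IsProbabilityMeasure μ] (hX : Measurable X) (y : ℝ) :
    ∫ ω, max (X ω - y) 0 ∂μ =
      μ.real {ω | y < X ω} * ∫ ω, (X ω - y) ∂(cond μ {ω | y < X ω}) := by
  have hs : MeasurableSet {ω | y < X ω} := measurableSet_lt measurable_const hX
  have h1 : ∫ ω, max (X ω - y) 0 ∂μ = ∫ ω in {ω | y < X ω}, (X ω - y) ∂μ := by
    rw [← integral_indicator hs]
    congr 1
    ext ω
    by_cases hω : y < X ω
    · rw [Set.indicator_of_mem (by exact hω), max_eq_left (by linarith)]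
    · rw [Set.indicator_of_notMem (by exact hω), max_eq_right (by linarith)]
  rw [h1, ProbabilityTheory.cond, integral_smul_measure]
  by_cases h0 : μ {ω | y < X ω} = 0
  · simp [Measure.restrict_eq_zero.2 h0]
  · rw [smul_eq_mul, ENNReal.toReal_inv, ← mul_assoc, Measure.real, mul_inv_cancel₀, one_mul]
    exact ENNReal.toReal_ne_zero.2 ⟨h0, measure_ne_top _ _⟩

/-- For unbounded demand with `E[X - d | X > d] = o(d)`, raising the shortage cost from `a * n` to
`b * n` at the optimal stock `y` for `a * n` costs `(b - a) * n * E[(X - y)⁺]`, which is at most a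
multiple of `E[X - y | X > y]`, while the holding cost alone is of order `y`. -/
theorem newsvendorValue_le_of_unbounded [IsProbabilityMeasure μ] (hX : Measurable X)
    (hXi : Integrable X μ) (hX0 : ∀ᵐ ω ∂μ, 0 ≤ X ω) (hh : 0 < h)
    (hM : ¬ ∃ M : ℝ, ∀ᵐ ω ∂μ, X ω ≤ M)
    (htail : Tendsto (fun d : ℝ => (∫ ω, (X ω - d) ∂(cond μ {ω | d < X ω})) / d) atTop (𝓝 0))
    {a b ε : ℝ} (ha : 0 < a) (hab : a < b) (hε : 0 < ε) :
    ∀ᶠ n : ℝ in atTop, newsvendorValue μ X h (b * n) ≤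
      ENNReal.ofReal (1 + ε) * newsvendorValue μ X h (a * n) := by
  set m := ∫ ω, X ω ∂μ with hm
  set e : ℝ → ℝ := fun y => ∫ ω, (X ω - y) ∂(cond μ {ω | y < X ω}) with he
  have hba : 0 < b - a := sub_pos.2 hab
  obtain ⟨Y, hY⟩ := eventually_atTop.1
    (htail.eventually (gt_mem_nhds (by positivity : 0 < ε * a / (2 * (b - a)))))
  -- beyond `Y'` the mean excess is small compared to the stock, and the stock is at least twice
  -- the mean demand
  set Y' := max Y (max 1 (2 * m)) with hY'
  have hFpos : 0 < μ.real {ω | Y' < X ω} := by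
    refine ENNReal.toReal_pos (fun h0 => hM ⟨Y', ?_⟩) (measure_ne_top _ _)
    have : ∀ᵐ ω ∂μ, ¬ Y' < X ω := by
      rw [ae_iff]
      simpa using h0
    filter_upwards [this] with ω hω using not_lt.1 hω
  have hτlim : Tendsto (fun n : ℝ => h / (h + a * n)) atTop (𝓝 0) :=
    tendsto_const_nhds.div_atTop
      (tendsto_atTop_add_const_left _ _ (tendsto_id.const_mul_atTop ha))
  filter_upwards [hτlim.eventually (gt_mem_nhds hFpos), eventually_gt_atTop 0] with n hn hn0
  have han : 0 < a * n := by positivity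
  have hbn : 0 < b * n := mul_pos (ha.trans hab) hn0
  obtain ⟨y, hy1, hy2⟩ := exists_quantile hX hX0 (τ := h / (h + a * n)) (by positivity)
    ((div_lt_one (by positivity)).2 (by linarith))
  have hyY : Y' < y := by
    by_contra! hle
    have : μ.real {ω | Y' < X ω} ≤ μ.real {ω | y < X ω} :=
      measureReal_mono fun ω hω => lt_of_le_of_lt hle hω
    linarith
  have hyY1 : Y ≤ y := (le_max_left _ _).trans hyY.le
  have hy0 : 1 ≤ y := ((le_max_left 1 (2 * m)).trans (le_max_right _ _)).trans hyY.le
  have hym : 2 * m ≤ y := ((le_max_right 1 (2 * m)).trans (le_max_right _ _)).trans hyY.le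
  have hexc : e y ≤ ε * a / (2 * (b - a)) * y :=
    ((div_lt_iff₀ (by linarith : (0 : ℝ) < y)).1 (hY y hyY1)).le
  have hval : newsvendorValue μ X h (a * n) = newsvendorCost μ X h (a * n) y :=
    le_antisymm (iInf_le _ y)
      (le_iInf fun z => newsvendorCost_le_of_quantile hX hXi hh han hy1 hy2 z)
  rw [hval]
  refine (iInf_le _ y).trans ?_
  rw [newsvendorCost_eq_ofReal hXi hh.le han.le, newsvendorCost_eq_ofReal hXi hh.le hbn.le,
    ← ENNReal.ofReal_mul (by linarith)]
  refine ENNReal.ofReal_le_ofReal ?_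
  have hsi : Integrable (fun ω => max (X ω - y) 0) μ := (hXi.sub (integrable_const y)).pos_part
  have hsplit : ∫ ω, newsvendorLoss h (b * n) y (X ω) ∂μ =
      ∫ ω, newsvendorLoss h (a * n) y (X ω) ∂μ + (b - a) * n * ∫ ω, max (X ω - y) 0 ∂μ := by
    rw [← integral_const_mul, ← integral_add (integrable_newsvendorLoss hXi _ _ _)
      (hsi.const_mul _)]
    congr 1
    ext ω
    unfold newsvendorLoss
    ring
  have hlow : h * (y - m) ≤ ∫ ω, newsvendorLoss h (a * n) y (X ω) ∂μ := by
    have : ∫ ω, h * (y - X ω) ∂μ = h * (y - m) := by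
      rw [integral_const_mul, integral_sub (integrable_const y) hXi]; simp [hm]
    rw [← this]
    refine integral_mono (((integrable_const y).sub hXi).const_mul h)
      (integrable_newsvendorLoss hXi _ _ _) fun ω => ?_
    have h1 := mul_le_mul_of_nonneg_left (le_max_left (y - X ω) 0) hh.le
    have h2 := mul_nonneg han.le (le_max_right (X ω - y) 0)
    simp only [newsvendorLoss]
    linarith
  have hshort : n * ∫ ω, max (X ω - y) 0 ∂μ ≤ h / a * (ε * a / (2 * (b - a)) * y) := by
    rw [integral_max_sub_zero hX, ← mul_assoc]
    have h1 : n * μ.real {ω | y < X ω} ≤ h / a := by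
      rw [le_div_iff₀ ha]
      have h3 := (le_div_iff₀ (by positivity)).1 hy1
      nlinarith [measureReal_nonneg (μ := μ) (s := {ω | y < X ω})]
    calc n * μ.real {ω | y < X ω} * e y
        ≤ n * μ.real {ω | y < X ω} * (ε * a / (2 * (b - a)) * y) := by gcongr
      _ ≤ h / a * (ε * a / (2 * (b - a)) * y) :=
        mul_le_mul_of_nonneg_right h1 (by positivity)
  rw [hsplit]
  have h5 : (b - a) * (h / a * (ε * a / (2 * (b - a)) * y)) = ε * (h * (y / 2)) := by
    field_simp
  have h6 := mul_le_mul_of_nonneg_left hshort hba.le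
  have h7 : ε * (h * (y / 2)) ≤ ε * (h * (y - m)) := by gcongr; linarith
  have h8 := mul_le_mul_of_nonneg_left hlow hε.le
  rw [h5] at h6
  linarith

/-- Under the tail assumption, multiplying the shortage cost by a constant factor does not change
the newsvendor value asymptotically. -/
theorem newsvendorValue_eventually_le [IsProbabilityMeasure μ] (hX : Measurable X)
    (hX0 : ∀ᵐ ω ∂μ, 0 ≤ X ω) (hh : 0 < h) (hpos : 0 < newsvendorValue μ X h 1)
    (htail : TailAssumption μ X) {a b ε : ℝ} (ha : 0 < a) (hab : a < b) (hε : 0 < ε) :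
    ∀ᶠ n : ℝ in atTop, newsvendorValue μ X h (b * n) ≤
      ENNReal.ofReal (1 + ε) * newsvendorValue μ X h (a * n) := by
  rcases htail.2 with ⟨M, hM⟩ | ⟨hM, ht⟩
  · exact newsvendorValue_le_of_bounded hX0 hh hpos hM ha hε
  · exact newsvendorValue_le_of_unbounded hX htail.1.1 hX0 hh hM ht ha hab hε

end Asymptotics

/-! ### Inventory balance -/

theorem netInventory_eq (a d : ℕ → ℝ) (t : ℕ) :
    netInventory a d t = ∑ s ∈ Finset.range (t + 1), a s - ∑ s ∈ Finset.range t, d s := by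
  induction t with
  | zero => simp [netInventory]
  | succ t ih =>
    rw [netInventory, ih, Finset.sum_range_succ a (t + 1), Finset.sum_range_succ d t]
    ring

theorem sum_arrival (q : ℕ → ℝ) (L t : ℕ) :
    ∑ s ∈ Finset.range (t + 1), arrival q L s = ∑ j ∈ Finset.range (t + 1 - L), q j := by
  induction t with
  | zero =>
    rcases Nat.eq_zero_or_pos L with rfl | hL
    · simp [arrival]
    · have : 0 + 1 - L = 0 := by omega
      rw [this]
      simp [arrival, hL.ne']
  | succ t ih =>
    rw [Finset.sum_range_succ, ih, arrival]
    split_ifs with hL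
    · rw [show t + 1 + 1 - L = t + 1 - L + 1 by omega, Finset.sum_range_succ]
    · rw [show t + 1 + 1 - L = t + 1 - L by omega, add_zero]

theorem Policy.inv_eq (π : Policy) (le lr : ℕ) (d : ℕ → ℝ) (t : ℕ) :
    π.inv le lr d t = ∑ j ∈ Finset.range (t + 1 - le), π.qe d j
      + ∑ j ∈ Finset.range (t + 1 - lr), π.qr d j - ∑ i ∈ Finset.range t, d i := by
  rw [Policy.inv, netInventory_eq, Finset.sum_add_distrib, sum_arrival, sum_arrival]

/-- The inventory position after ordering in period `t`: everything ordered so far, minus the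
demand so far. -/
def Policy.position (π : Policy) (d : ℕ → ℝ) (t : ℕ) : ℝ :=
  ∑ j ∈ Finset.range (t + 1), (π.qe d j + π.qr d j) - ∑ i ∈ Finset.range t, d i

/-- When the regular order of period `s` arrives, the net inventory consists of the inventory
position of period `s` and the expedited orders placed in the next `lr - le` periods, minus the
demand during the regular lead time. -/
theorem Policy.inv_sub_demand (π : Policy) {le lr : ℕ} (hl : le < lr) (d : ℕ → ℝ) (s : ℕ) :
    π.inv le lr d (s + lr) - d (s + lr) =
      π.position d s + ∑ j ∈ Finset.range (lr - le), π.qe d (s + 1 + j)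
        - ∑ i ∈ Finset.range (lr + 1), d (s + i) := by
  rw [Policy.inv_eq, Policy.position, show s + lr + 1 - le = s + 1 + (lr - le) by omega,
    show s + lr + 1 - lr = s + 1 by omega, Finset.sum_range_add (fun j => π.qe d j),
    Finset.sum_range_add (fun j => d j), Finset.sum_add_distrib,
    Finset.sum_range_succ (fun i => d (s + i)) lr]
  ring

theorem Policy.invReview_add_outstanding (π : Policy) {le lr : ℕ} (hl : le < lr) (d : ℕ → ℝ)
    (t : ℕ) :
    π.invReview le lr d t + ∑ i ∈ (Finset.range t).filter (fun i => t < i + le), π.qe d i =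
      ∑ j ∈ Finset.range t, π.qe d j + ∑ j ∈ Finset.range (t + 1 - lr), π.qr d j
        - ∑ i ∈ Finset.range t, d i := by
  rw [Policy.invReview, Policy.inv_eq]
  split_ifs with h0
  · subst h0
    have : (Finset.range t).filter (fun i => t < i + 0) = ∅ := by
      ext i; simp; omega
    rw [this, Nat.sub_zero, Finset.sum_range_succ, Finset.sum_empty]
    ring
  · rw [← Finset.sum_filter_add_sum_filter_not (Finset.range t) (fun i => t < i + le)
      (fun j => π.qe d j)]
    have : (Finset.range t).filter (fun i => ¬ t < i + le) = Finset.range (t + 1 - le) := by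
      ext i; simp; omega
    rw [this]
    ring

theorem Policy.regularPosition_eq (π : Policy) {le lr : ℕ} (hl : le < lr) (d : ℕ → ℝ) (t : ℕ) :
    π.regularPosition le lr d t =
      ∑ j ∈ Finset.range t, (π.qe d j + π.qr d j) - ∑ i ∈ Finset.range t, d i := by
  rw [Policy.regularPosition, π.invReview_add_outstanding hl, Finset.sum_add_distrib,
    ← Finset.sum_filter_add_sum_filter_not (Finset.range t) (fun i => t < i + lr)
      (fun j => π.qr d j)]
  have : (Finset.range t).filter (fun i => ¬ t < i + lr) = Finset.range (t + 1 - lr) := by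
    ext i; simp; omega
  rw [this]
  ring

theorem Policy.expeditedPosition_eq (π : Policy) {le lr : ℕ} (hl : le < lr) (d : ℕ → ℝ) (t : ℕ) :
    π.expeditedPosition le lr d t =
      ∑ j ∈ Finset.range t, π.qe d j + ∑ j ∈ Finset.range (t + 1 - (lr - le)), π.qr d j
        - ∑ i ∈ Finset.range t, d i := by
  rw [Policy.expeditedPosition, π.invReview_add_outstanding hl]
  have h1 : (Finset.range t).filter (fun i => t < i + lr ∧ i + lr ≤ t + le) =
      Finset.Ico (t + 1 - lr) (t + 1 - (lr - le)) := by
    ext i; simp; omega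
  rw [h1, ← Finset.sum_range_add_sum_Ico (fun j => π.qr d j)
    (by omega : t + 1 - lr ≤ t + 1 - (lr - le))]
  ring

/-- A single-supplier policy, as a policy that never expedites. -/
def SinglePolicy.toPolicy (σ : SinglePolicy) : Policy where
  expedited _ _ := 0
  regular := σ.order
  expedited_nonneg _ _ := le_rfl
  regular_nonneg := σ.order_nonneg
  measurable_expedited _ := measurable_const
  measurable_regular := σ.measurable_order

theorem SinglePolicy.toPolicy_qe (σ : SinglePolicy) (d : ℕ → ℝ) (t : ℕ) :
    σ.toPolicy.qe d t = 0 := rfl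

theorem SinglePolicy.periodCost_toPolicy (σ : SinglePolicy) (le L : ℕ) (h p ce : ℝ) (d : ℕ → ℝ)
    (t : ℕ) : σ.toPolicy.periodCost le L h p ce d t = σ.periodCost L h p d t := by
  have hinv : σ.toPolicy.inv le L d t = σ.inv L d t := by
    rw [Policy.inv_eq, SinglePolicy.inv, netInventory_eq, sum_arrival]
    simp only [SinglePolicy.toPolicy_qe, Finset.sum_const_zero, zero_add]
    rfl
  rw [Policy.periodCost, SinglePolicy.periodCost, hinv, SinglePolicy.toPolicy_qe, mul_zero,
    zero_add]

theorem SinglePolicy.cost_toPolicy {Ω : Type*} [MeasurableSpace Ω] (σ : SinglePolicy)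
    (μ : Measure Ω) (D : ℕ → Ω → ℝ) (le L : ℕ) (h p ce : ℝ) :
    σ.toPolicy.cost μ D le L h p ce = σ.cost μ D L h p := by
  simp only [Policy.cost, SinglePolicy.cost, SinglePolicy.periodCost_toPolicy]

/-! ### Long-run averages -/

section LongRun

variable {Ω : Type*} [MeasurableSpace Ω] {μ : Measure Ω}

/-- A long-run average is not affected by finitely many periods of finite cost. -/
theorem longRunAverage_le {C : ℕ → Ω → ℝ} {L : ℕ} {K K₀ : ℝ≥0∞} (hK₀ : K₀ ≠ ⊤)
    (h₀ : ∀ t < L, ∫⁻ ω, ENNReal.ofReal (C t ω) ∂μ ≤ K₀)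
    (h₁ : ∀ t, L ≤ t → ∫⁻ ω, ENNReal.ofReal (C t ω) ∂μ ≤ K) : longRunAverage μ C ≤ K := by
  have hsum : ∀ T : ℕ, ∑ t ∈ Finset.Icc 1 T, ∫⁻ ω, ENNReal.ofReal (C t ω) ∂μ ≤
      L * K₀ + T * K := by
    intro T
    calc ∑ t ∈ Finset.Icc 1 T, ∫⁻ ω, ENNReal.ofReal (C t ω) ∂μ
        ≤ ∑ t ∈ Finset.Icc 1 T, ((if t < L then K₀ else 0) + K) := by
          refine Finset.sum_le_sum fun t _ => ?_
          split_ifs with ht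
          · exact (h₀ t ht).trans le_self_add
          · exact (h₁ t (not_lt.1 ht)).trans le_add_self
      _ = ((Finset.Icc 1 T).filter (· < L)).card * K₀ + T * K := by
          rw [Finset.sum_add_distrib, ← Finset.sum_filter]
          simp
      _ ≤ L * K₀ + T * K := by
          gcongr
          calc ((Finset.Icc 1 T).filter (· < L)).card ≤ (Finset.range L).card :=
                Finset.card_le_card fun t ht => by simp at ht ⊢; omega
            _ = L := Finset.card_range L
  have hdiv : Tendsto (fun T : ℕ => L * K₀ / (T : ℝ≥0∞)) atTop (𝓝 (L * K₀ / ⊤)) :=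
    ENNReal.Tendsto.const_div ENNReal.tendsto_nat_nhds_top
      (Or.inr (ENNReal.mul_ne_top (ENNReal.natCast_ne_top L) hK₀))
  rw [ENNReal.div_top] at hdiv
  have hlim := hdiv.add (tendsto_const_nhds (x := K))
  rw [zero_add] at hlim
  rw [← hlim.limsup_eq]
  refine limsup_le_limsup ?_
  filter_upwards [eventually_gt_atTop 0] with T hT
  have hT0 : (T : ℝ≥0∞) ≠ 0 := by exact_mod_cast hT.ne'
  calc (∑ t ∈ Finset.Icc 1 T, ∫⁻ ω, ENNReal.ofReal (C t ω) ∂μ) / (T : ℝ≥0∞)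
      ≤ (L * K₀ + T * K) / T := by gcongr; exact hsum T
    _ = L * K₀ / T + K := by
        rw [ENNReal.add_div, mul_comm (T : ℝ≥0∞) K,
          ENNReal.mul_div_cancel_right hT0 (ENNReal.natCast_ne_top T)]

theorem le_longRunAverage {C : ℕ → Ω → ℝ} {L : ℕ} {K : ℝ≥0∞}
    (h : ∀ T, L ≤ T → (T + 1 - L : ℕ) * K ≤
      ∑ t ∈ Finset.Icc 1 T, ∫⁻ ω, ENNReal.ofReal (C t ω) ∂μ) : K ≤ longRunAverage μ C := by
  have hreal : Tendsto (fun T : ℕ => ((T + 1 - L : ℕ) : ℝ) / T) atTop (𝓝 1) := by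
    have h1 : Tendsto (fun T : ℕ => 1 + (1 - L : ℝ) / (T : ℝ)) atTop (𝓝 (1 + 0)) :=
      tendsto_const_nhds.add (tendsto_const_div_atTop_nhds_zero_nat _)
    rw [add_zero] at h1
    refine h1.congr' ?_
    filter_upwards [eventually_ge_atTop (L + 1)] with T hT
    have hT0 : (T : ℝ) ≠ 0 := by
      have : T ≠ 0 := by omega
      exact_mod_cast this
    rw [Nat.cast_sub (by omega)]
    push_cast
    field_simp
    ring
  have hlim : Tendsto (fun T : ℕ => ENNReal.ofReal (((T + 1 - L : ℕ) : ℝ) / T) * K) atTop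
      (𝓝 (ENNReal.ofReal 1 * K)) :=
    ENNReal.Tendsto.mul_const (ENNReal.tendsto_ofReal hreal) (Or.inl (by simp))
  rw [ENNReal.ofReal_one, one_mul] at hlim
  rw [← hlim.limsup_eq]
  refine limsup_le_limsup ?_
  filter_upwards [eventually_ge_atTop (L + 1)] with T hT
  have hT0 : (0 : ℝ) < T := by
    have : 0 < T := by omega
    exact_mod_cast this
  rw [ENNReal.ofReal_div_of_pos hT0, ENNReal.ofReal_natCast, ENNReal.ofReal_natCast, div_eq_mul_inv,
    mul_right_comm, ← div_eq_mul_inv]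
  gcongr
  exact h T (by omega)

theorem sum_range_shift_le (f : ℕ → ℝ≥0∞) {k m T : ℕ} (hk : 1 ≤ k) (hm : m + k ≤ T + 1) :
    ∑ s ∈ Finset.range m, f (s + k) ≤ ∑ t ∈ Finset.Icc 1 T, f t := by
  rw [Finset.range_eq_Ico, Finset.sum_Ico_add' f 0 m k]
  exact Finset.sum_le_sum_of_subset fun t ht => by simp at ht ⊢; omega

end LongRun

/-! ### The demand process -/

section Demand

variable {Ω : Type*} [MeasurableSpace Ω] {μ : Measure Ω} {D : ℕ → Ω → ℝ}

theorem measurable_cumulativeDemand (hD : ∀ t, Measurable (D t)) (n : ℕ) :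
    Measurable (cumulativeDemand D n) :=
  Finset.measurable_sum _ fun i _ => hD i

/-- The demand of `n` consecutive periods has the same law wherever the periods start. -/
theorem identDistrib_windowDemand (hind : iIndepFun D μ)
    (hid : ∀ t, IdentDistrib (D t) (D 0) μ μ) (s n : ℕ) :
    IdentDistrib (fun ω => ∑ i ∈ Finset.range n, D (s + i) ω) (cumulativeDemand D n) μ μ := by
  have h1 : IdentDistrib (fun ω i => D (s + i) ω) (fun ω i => D i ω) μ μ :=
    IdentDistrib.pi (fun i => (hid (s + i)).trans (hid i).symm)
      (hind.precomp (add_right_injective s)) hind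
  exact h1.comp (u := fun x : ℕ → ℝ => ∑ i ∈ Finset.range n, x i)
    (Finset.measurable_sum _ fun i _ => measurable_pi_apply i)

/-- Quantities determined by the demand before period `s` are independent of the demand of the
periods `s, …, s + n - 1`. -/
theorem indepFun_history_windowDemand (hD : ∀ t, Measurable (D t)) (hind : iIndepFun D μ)
    {Y : (ℕ → ℝ) → ℝ} (hY : Measurable Y) {s : ℕ}
    (hYs : ∀ d d' : ℕ → ℝ, (∀ i < s, d i = d' i) → Y d = Y d') (n : ℕ) :
    IndepFun (fun ω => Y fun i => D i ω) (fun ω => ∑ i ∈ Finset.range n, D (s + i) ω) μ := by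
  have hdisj : Disjoint (Finset.range s) (Finset.Ico s (s + n)) := by
    rw [Finset.disjoint_left]
    intro i hi hi'
    simp at hi hi'
    omega
  have h := hind.indepFun_finset _ _ hdisj hD
  let ext : (Finset.range s → ℝ) → ℕ → ℝ :=
    fun x i => if hi : i ∈ Finset.range s then x ⟨i, hi⟩ else 0
  have hext : Measurable ext := by
    refine measurable_pi_lambda _ fun i => ?_
    by_cases hi : i ∈ Finset.range s
    · simpa only [ext, hi, dif_pos] using measurable_pi_apply _
    · simpa only [ext, hi, dif_neg, not_false_eq_true] using measurable_const
  have h' := h.comp (hY.comp hext) (ψ := fun x : Finset.Ico s (s + n) → ℝ => ∑ i, x i)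
    (Finset.measurable_sum _ fun i _ => measurable_pi_apply i)
  convert h' using 1
  · ext ω
    refine hYs _ _ fun i hi => ?_
    simp [ext, hi]
  · ext ω
    rw [Function.comp_apply, Finset.sum_coe_sort (Finset.Ico s (s + n)) fun i => D i ω,
      Finset.sum_Ico_eq_sum_range]
    simp

/-- A stock level that is chosen before the demand is observed cannot beat the newsvendor value. -/
theorem newsvendorValue_le_lintegral [IsProbabilityMeasure μ] (hD : ∀ t, Measurable (D t)) (hind : iIndepFun D μ)
    (hid : ∀ t, IdentDistrib (D t) (D 0) μ μ) {Y : (ℕ → ℝ) → ℝ} (hY : Measurable Y) {s : ℕ}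
    (hYs : ∀ d d' : ℕ → ℝ, (∀ i < s, d i = d' i) → Y d = Y d') (h p : ℝ) (n : ℕ) :
    newsvendorValue μ (cumulativeDemand D n) h p ≤
      ∫⁻ ω, ENNReal.ofReal (newsvendorLoss h p (Y fun i => D i ω)
        (∑ i ∈ Finset.range n, D (s + i) ω)) ∂μ := by
  have hYm : Measurable fun ω => Y fun i => D i ω := hY.comp (measurable_pi_lambda _ hD)
  have hWm : Measurable fun ω => ∑ i ∈ Finset.range n, D (s + i) ω :=
    Finset.measurable_sum _ fun i _ => hD _
  have hloss : Measurable fun z : ℝ × ℝ => ENNReal.ofReal (newsvendorLoss h p z.1 z.2) :=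
    (measurable_newsvendorLoss measurable_fst measurable_snd).ennreal_ofReal
  have hind' := (indepFun_iff_map_prod_eq_prod_map_map hYm.aemeasurable hWm.aemeasurable).1
    (indepFun_history_windowDemand hD hind hY hYs n)
  have := Measure.isProbabilityMeasure_map (μ := μ) hYm.aemeasurable
  rw [← lintegral_map (μ := μ) hloss (hYm.prodMk hWm), hind', lintegral_prod _ hloss.aemeasurable]
  calc newsvendorValue μ (cumulativeDemand D n) h p
      = ∫⁻ _, newsvendorValue μ (cumulativeDemand D n) h p ∂(μ.map fun ω => Y fun i => D i ω) := by
        simp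
    _ ≤ _ := by
        refine lintegral_mono fun y => ?_
        have hy : Measurable fun x : ℝ => ENNReal.ofReal (newsvendorLoss h p y x) :=
          (measurable_newsvendorLoss measurable_const measurable_id).ennreal_ofReal
        refine (iInf_le _ y).trans (le_of_eq ?_)
        rw [(identDistrib_windowDemand hind hid s n).map_eq,
          lintegral_map hy (measurable_cumulativeDemand hD n)]
        rfl

end Demand

/-! ### Cost bounds for a policy -/

theorem Policy.qe_nonneg (π : Policy) (d : ℕ → ℝ) (t : ℕ) : 0 ≤ π.qe d t :=
  π.expedited_nonneg _ _

theorem Policy.qr_nonneg (π : Policy) (d : ℕ → ℝ) (t : ℕ) : 0 ≤ π.qr d t :=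
  π.regular_nonneg _ _

theorem Policy.measurable_qe (π : Policy) (t : ℕ) : Measurable fun d => π.qe d t :=
  (π.measurable_expedited t).comp (measurable_pi_lambda _ fun i => measurable_pi_apply (i : ℕ))

theorem Policy.measurable_qr (π : Policy) (t : ℕ) : Measurable fun d => π.qr d t :=
  (π.measurable_regular t).comp (measurable_pi_lambda _ fun i => measurable_pi_apply (i : ℕ))

theorem Policy.qe_congr (π : Policy) {d d' : ℕ → ℝ} {t : ℕ} (hd : ∀ i < t, d i = d' i) :
    π.qe d t = π.qe d' t :=
  congrArg (π.expedited t) (funext fun i => hd i i.2)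

theorem Policy.qr_congr (π : Policy) {d d' : ℕ → ℝ} {t : ℕ} (hd : ∀ i < t, d i = d' i) :
    π.qr d t = π.qr d' t :=
  congrArg (π.regular t) (funext fun i => hd i i.2)

theorem Policy.measurable_position (π : Policy) (t : ℕ) : Measurable fun d => π.position d t :=
  (Finset.measurable_sum _ fun j _ => (π.measurable_qe j).add (π.measurable_qr j)).sub
    (Finset.measurable_sum _ fun i _ => measurable_pi_apply i)

theorem Policy.position_congr (π : Policy) {d d' : ℕ → ℝ} {t : ℕ} (hd : ∀ i < t, d i = d' i) :
    π.position d t = π.position d' t := by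
  unfold Policy.position
  refine congrArg₂ _ (Finset.sum_congr rfl fun j hj => ?_)
    (Finset.sum_congr rfl fun i hi => hd i (Finset.mem_range.1 hi))
  have hj' : ∀ i < j, d i = d' i := fun i hi => hd i (by rw [Finset.mem_range] at hj; omega)
  rw [π.qe_congr hj', π.qr_congr hj']

/-- The holding and backlog cost of period `s + lr` is a newsvendor loss whose stock is the
inventory position of period `s` increased by the expedited orders of the next `lr - le`
periods. -/
theorem Policy.periodCost_eq (π : Policy) {le lr : ℕ} (hl : le < lr) (h p ce : ℝ) (d : ℕ → ℝ)
    (s : ℕ) :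
    π.periodCost le lr h p ce d (s + lr) = ce * π.qe d (s + lr) +
      newsvendorLoss h p (π.position d s + ∑ j ∈ Finset.range (lr - le), π.qe d (s + 1 + j))
        (∑ i ∈ Finset.range (lr + 1), d (s + i)) := by
  have h1 := π.inv_sub_demand hl d s
  have h2 : d (s + lr) - π.inv le lr d (s + lr) = ∑ i ∈ Finset.range (lr + 1), d (s + i) -
      (π.position d s + ∑ j ∈ Finset.range (lr - le), π.qe d (s + 1 + j)) := by linarith
  rw [Policy.periodCost, h1, h2, newsvendorLoss, add_assoc]

/-- Paying `c ≤ p` per unit of additional stock `e` cannot beat the shortage cost `c`. -/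
theorem newsvendorLoss_le_add {h p c e : ℝ} (hh : 0 ≤ h) (hc : 0 ≤ c) (hcp : c ≤ p) (he : 0 ≤ e)
    (y x : ℝ) : newsvendorLoss h c y x ≤ newsvendorLoss h p (y + e) x + c * e := by
  have h1 : h * max (y - x) 0 ≤ h * max (y + e - x) 0 :=
    mul_le_mul_of_nonneg_left (max_le_max (by linarith) le_rfl) hh
  have h2 : max (x - y) 0 ≤ max (x - (y + e)) 0 + e :=
    max_le (by linarith [le_max_left (x - (y + e)) 0])
      (by linarith [le_max_right (x - (y + e)) 0])
  have h3 := mul_le_mul_of_nonneg_left h2 hc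
  have h4 := mul_le_mul_of_nonneg_right hcp (le_max_right (x - (y + e)) 0)
  unfold newsvendorLoss
  linarith

/-- Additional stock `e` costs at most its holding cost. -/
theorem newsvendorLoss_add_le {h p e : ℝ} (hh : 0 ≤ h) (hp : 0 ≤ p) (he : 0 ≤ e) (y x : ℝ) :
    newsvendorLoss h p (y + e) x ≤ newsvendorLoss h p y x + h * e := by
  have h1 : p * max (x - (y + e)) 0 ≤ p * max (x - y) 0 :=
    mul_le_mul_of_nonneg_left (max_le_max (by linarith) le_rfl) hp
  have h2 : max (y + e - x) 0 ≤ max (y - x) 0 + e :=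
    max_le (by linarith [le_max_left (y - x) 0]) (by linarith [le_max_right (y - x) 0])
  have h3 := mul_le_mul_of_nonneg_left h2 hh
  unfold newsvendorLoss
  linarith

section CostBounds

variable {Ω : Type*} [MeasurableSpace Ω] {μ : Measure Ω} {D : ℕ → Ω → ℝ}

/-- The expected expedited order of period `t`. -/
def Policy.meanExpedited (π : Policy) (μ : Measure Ω) (D : ℕ → Ω → ℝ) (t : ℕ) : ℝ≥0∞ :=
  ∫⁻ ω, ENNReal.ofReal (π.qe (fun s => D s ω) t) ∂μ

theorem Policy.measurable_qe_demand (π : Policy) (hD : ∀ t, Measurable (D t)) (t : ℕ) :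
    Measurable fun ω => π.qe (fun s => D s ω) t :=
  (π.measurable_qe t).comp (measurable_pi_lambda _ hD)

theorem Policy.lintegral_const_mul_sum_qe (π : Policy) (hD : ∀ t, Measurable (D t)) {c : ℝ}
    (hc : 0 ≤ c) (k n : ℕ) :
    ∫⁻ ω, ENNReal.ofReal (c * ∑ j ∈ Finset.range n, π.qe (fun s => D s ω) (k + j)) ∂μ =
      ENNReal.ofReal c * ∑ j ∈ Finset.range n, π.meanExpedited μ D (k + j) := by
  simp_rw [ENNReal.ofReal_mul hc, ENNReal.ofReal_sum_of_nonneg fun j _ => π.qe_nonneg _ _]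
  rw [lintegral_const_mul _ (Finset.measurable_sum _ fun j _ =>
    (π.measurable_qe_demand hD _).ennreal_ofReal),
    lintegral_finsetSum _ fun j _ => (π.measurable_qe_demand hD _).ennreal_ofReal]
  rfl

/-- Every policy costs at least the newsvendor value for a shortage cost `c ≤ p` with
`(lr - le) * c ≤ ce`: the premium of an expedited unit pays `c` in each of the `lr - le` lead-time
windows in which the unit is counted. -/
theorem Policy.newsvendorValue_le_cost [IsProbabilityMeasure μ] (π : Policy)
    (hD : ∀ t, Measurable (D t)) (hind : iIndepFun D μ)
    (hid : ∀ t, IdentDistrib (D t) (D 0) μ μ) {le lr : ℕ} (hl : le < lr) {h p ce c : ℝ}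
    (hh : 0 ≤ h) (hc : 0 ≤ c) (hcp : c ≤ p) (hcce : (lr - le : ℕ) * c ≤ ce) :
    newsvendorValue μ (cumulativeDemand D (lr + 1)) h c ≤ π.cost μ D le lr h p ce := by
  have hce : 0 ≤ ce := le_trans (by positivity) hcce
  have hp : 0 ≤ p := hc.trans hcp
  set A := π.meanExpedited μ D with hA
  set l := lr - le with hl'
  let B : ℕ → ℝ≥0∞ := fun t => ∫⁻ ω, ENNReal.ofReal
    (h * max (π.inv le lr (fun s => D s ω) t - D t ω) 0
      + p * max (D t ω - π.inv le lr (fun s => D s ω) t) 0) ∂μ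
  have hBnn : ∀ (d : ℕ → ℝ) (t : ℕ),
      0 ≤ h * max (π.inv le lr d t - d t) 0 + p * max (d t - π.inv le lr d t) 0 := fun d t =>
    add_nonneg (mul_nonneg hh (le_max_right _ _)) (mul_nonneg hp (le_max_right _ _))
  have hcost : ∀ t, ∫⁻ ω, ENNReal.ofReal (π.periodCost le lr h p ce (fun s => D s ω) t) ∂μ =
      ENNReal.ofReal ce * A t + B t := by
    intro t
    simp only [Policy.periodCost, add_assoc]
    simp_rw [ENNReal.ofReal_add (mul_nonneg hce (π.qe_nonneg _ _)) (hBnn _ _),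
      ENNReal.ofReal_mul hce]
    rw [lintegral_add_left ((π.measurable_qe_demand hD t).ennreal_ofReal.const_mul _),
      lintegral_const_mul _ (π.measurable_qe_demand hD t).ennreal_ofReal]
    rfl
  have hkey : ∀ s, newsvendorValue μ (cumulativeDemand D (lr + 1)) h c ≤
      B (s + lr) + ENNReal.ofReal c * ∑ j ∈ Finset.range l, A (s + 1 + j) := by
    intro s
    refine (newsvendorValue_le_lintegral hD hind hid (π.measurable_position s)
      (fun d d' hd => π.position_congr hd) h c (lr + 1)).trans ?_
    rw [hA, ← π.lintegral_const_mul_sum_qe hD hc, ← lintegral_add_right _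
      ((Finset.measurable_sum _ fun j _ =>
        π.measurable_qe_demand hD (s + 1 + j)).const_mul c).ennreal_ofReal]
    refine lintegral_mono fun ω => ?_
    have he : 0 ≤ ∑ j ∈ Finset.range l, π.qe (fun s => D s ω) (s + 1 + j) :=
      Finset.sum_nonneg fun j _ => π.qe_nonneg _ _
    simp only []
    rw [← ENNReal.ofReal_add (hBnn _ _) (mul_nonneg hc he)]
    refine ENNReal.ofReal_le_ofReal ((newsvendorLoss_le_add hh hc hcp he _ _).trans (le_of_eq ?_))
    have h1 := π.periodCost_eq hl h p ce (fun s => D s ω) s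
    rw [Policy.periodCost] at h1
    linarith
  refine le_longRunAverage (L := lr) fun T hT => ?_
  have hBsum : ∑ s ∈ Finset.range (T + 1 - lr), B (s + lr) ≤ ∑ t ∈ Finset.Icc 1 T, B t :=
    sum_range_shift_le B (by omega) (by omega)
  have hAsum : ∑ s ∈ Finset.range (T + 1 - lr), ∑ j ∈ Finset.range l, A (s + 1 + j) ≤
      l * ∑ t ∈ Finset.Icc 1 T, A t := by
    rw [Finset.sum_comm]
    calc ∑ j ∈ Finset.range l, ∑ s ∈ Finset.range (T + 1 - lr), A (s + 1 + j)
        ≤ ∑ j ∈ Finset.range l, ∑ t ∈ Finset.Icc 1 T, A t := by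
          refine Finset.sum_le_sum fun j hj => ?_
          rw [Finset.mem_range] at hj
          simp only [add_assoc]
          exact sum_range_shift_le A (by omega) (by omega)
      _ = l * ∑ t ∈ Finset.Icc 1 T, A t := by simp
  calc ((T + 1 - lr : ℕ) : ℝ≥0∞) * newsvendorValue μ (cumulativeDemand D (lr + 1)) h c
      = ∑ s ∈ Finset.range (T + 1 - lr),
          newsvendorValue μ (cumulativeDemand D (lr + 1)) h c := by simp
    _ ≤ ∑ s ∈ Finset.range (T + 1 - lr),
          (B (s + lr) + ENNReal.ofReal c * ∑ j ∈ Finset.range l, A (s + 1 + j)) :=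
        Finset.sum_le_sum fun s _ => hkey s
    _ ≤ ∑ t ∈ Finset.Icc 1 T, B t +
          ENNReal.ofReal c * (l * ∑ t ∈ Finset.Icc 1 T, A t) := by
        rw [Finset.sum_add_distrib, ← Finset.mul_sum]
        gcongr
    _ ≤ ∑ t ∈ Finset.Icc 1 T, B t + ENNReal.ofReal ce * ∑ t ∈ Finset.Icc 1 T, A t := by
        rw [← mul_assoc]
        gcongr
        rw [← ENNReal.ofReal_natCast, ← ENNReal.ofReal_mul hc, mul_comm]
        exact ENNReal.ofReal_le_ofReal hcce
    _ = ∑ t ∈ Finset.Icc 1 T,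
          ∫⁻ ω, ENNReal.ofReal (π.periodCost le lr h p ce (fun s => D s ω) t) ∂μ := by
        simp_rw [hcost]
        rw [Finset.sum_add_distrib, ← Finset.mul_sum, add_comm]

/-- A single supplier cannot beat the newsvendor value: this is the bound for dual sourcing, for a
premium so large that it does not matter. -/
theorem newsvendorValue_le_backlogOptimalCost [IsProbabilityMeasure μ]
    (hD : ∀ t, Measurable (D t)) (hind : iIndepFun D μ)
    (hid : ∀ t, IdentDistrib (D t) (D 0) μ μ) {L : ℕ} (hL : 0 < L) {h p : ℝ}
    (hh : 0 ≤ h) (hp : 0 ≤ p) :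
    newsvendorValue μ (cumulativeDemand D (L + 1)) h p ≤ backlogOptimalCost μ D L h p :=
  le_iInf fun σ => by
    rw [← σ.cost_toPolicy μ D 0 L h p ((L - 0 : ℕ) * p)]
    exact σ.toPolicy.newsvendorValue_le_cost hD hind hid hL hh hp le_rfl le_rfl

/-- A policy that keeps the inventory position at `S` costs at most the newsvendor cost of `S`, plus
a multiple of its expected expedited orders. -/
theorem Policy.cost_le_newsvendorCost [IsProbabilityMeasure μ] (π : Policy)
    (hD : ∀ t, Measurable (D t)) (hD0 : ∀ t, ∀ᵐ ω ∂μ, 0 ≤ D t ω) (hind : iIndepFun D μ)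
    (hid : ∀ t, IdentDistrib (D t) (D 0) μ μ) {le lr : ℕ} (hl : le < lr)
    (hXi : Integrable (cumulativeDemand D (lr + 1)) μ) {h p ce S : ℝ}
    (hh : 0 ≤ h) (hp : 0 ≤ p) (hce : 0 ≤ ce) (hS : 0 ≤ S)
    (hpos : ∀ᵐ ω ∂μ, ∀ t, π.position (fun s => D s ω) t = S) {ε : ℝ≥0∞} (hε : ε ≠ ⊤)
    (hqe : ∀ t, π.meanExpedited μ D t ≤ ε) :
    π.cost μ D le lr h p ce ≤ newsvendorCost μ (cumulativeDemand D (lr + 1)) h p S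
      + (ENNReal.ofReal ce + ENNReal.ofReal h * (lr - le : ℕ)) * ε := by
  have hD0' : ∀ᵐ ω ∂μ, ∀ t, 0 ≤ D t ω := ae_all_iff.2 hD0
  have hqm := π.measurable_qe_demand hD
  set X := cumulativeDemand D (lr + 1) with hX
  refine longRunAverage_le (L := lr)
    (K₀ := ENNReal.ofReal ce * ε + ∫⁻ ω, ENNReal.ofReal (h * S + p * X ω) ∂μ) ?_
    (fun t ht => ?_) (fun t ht => ?_)
  · exact ENNReal.add_ne_top.2 ⟨ENNReal.mul_ne_top ENNReal.ofReal_ne_top hε,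
      (((integrable_const (h * S)).add (hXi.const_mul p)).lintegral_lt_top).ne⟩
  -- until the first regular order arrives, the inventory lies between `-X` and `S`
  · have hbound : ∀ᵐ ω ∂μ, π.periodCost le lr h p ce (fun s => D s ω) t ≤
        ce * π.qe (fun s => D s ω) t + (h * S + p * X ω) := by
      filter_upwards [hpos, hD0'] with ω hω hdω
      have hI := π.inv_eq le lr (fun s => D s ω) t
      have hy := hω t
      rw [Policy.position, Finset.sum_add_distrib] at hy
      have h1 : ∑ j ∈ Finset.range (t + 1 - le), π.qe (fun s => D s ω) j ≤
          ∑ j ∈ Finset.range (t + 1), π.qe (fun s => D s ω) j :=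
        Finset.sum_le_sum_of_subset_of_nonneg (Finset.range_mono (by omega))
          fun _ _ _ => π.qe_nonneg _ _
      have h2 : ∑ j ∈ Finset.range (t + 1 - lr), π.qr (fun s => D s ω) j ≤
          ∑ j ∈ Finset.range (t + 1), π.qr (fun s => D s ω) j :=
        Finset.sum_le_sum_of_subset_of_nonneg (Finset.range_mono (by omega))
          fun _ _ _ => π.qr_nonneg _ _
      have h3 : ∑ i ∈ Finset.range (t + 1), D i ω ≤ X ω :=
        Finset.sum_le_sum_of_subset_of_nonneg (Finset.range_mono (by omega))
          fun _ _ _ => hdω _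
      rw [Finset.sum_range_succ] at h3
      have h4 : 0 ≤ ∑ j ∈ Finset.range (t + 1 - le), π.qe (fun s => D s ω) j :=
        Finset.sum_nonneg fun _ _ => π.qe_nonneg _ _
      have h5 : 0 ≤ ∑ j ∈ Finset.range (t + 1 - lr), π.qr (fun s => D s ω) j :=
        Finset.sum_nonneg fun _ _ => π.qr_nonneg _ _
      have h6 : 0 ≤ X ω := Finset.sum_nonneg fun _ _ => hdω _
      have h7 : max (π.inv le lr (fun s => D s ω) t - D t ω) 0 ≤ S :=
        max_le (by linarith [hdω t]) hS
      have h8 : max (D t ω - π.inv le lr (fun s => D s ω) t) 0 ≤ X ω :=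
        max_le (by linarith) h6
      rw [Policy.periodCost, add_assoc]
      gcongr
    calc ∫⁻ ω, ENNReal.ofReal (π.periodCost le lr h p ce (fun s => D s ω) t) ∂μ
        ≤ ∫⁻ ω, (ENNReal.ofReal ce * ENNReal.ofReal (π.qe (fun s => D s ω) t)
            + ENNReal.ofReal (h * S + p * X ω)) ∂μ := by
          refine lintegral_mono_ae (hbound.mono fun ω hω => ?_)
          rw [← ENNReal.ofReal_mul hce]
          exact (ENNReal.ofReal_le_ofReal hω).trans ENNReal.ofReal_add_le
      _ ≤ _ := by
          rw [lintegral_add_left ((hqm t).ennreal_ofReal.const_mul _),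
            lintegral_const_mul _ (hqm t).ennreal_ofReal]
          gcongr
          exact hqe t
  · obtain ⟨s, rfl⟩ : ∃ s, t = s + lr := ⟨t - lr, by omega⟩
    have hW : Measurable fun ω => ∑ i ∈ Finset.range (lr + 1), D (s + i) ω :=
      Finset.measurable_sum _ fun i _ => hD _
    have hloss : ∫⁻ ω, ENNReal.ofReal (newsvendorLoss h p S
        (∑ i ∈ Finset.range (lr + 1), D (s + i) ω)) ∂μ = newsvendorCost μ X h p S :=
      ((identDistrib_windowDemand hind hid s (lr + 1)).comp
        (measurable_newsvendorLoss (h := h) (p := p) (measurable_const (a := S))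
          measurable_id).ennreal_ofReal).lintegral_eq
    calc ∫⁻ ω, ENNReal.ofReal (π.periodCost le lr h p ce (fun s => D s ω) (s + lr)) ∂μ
        ≤ ∫⁻ ω, (ENNReal.ofReal ce * ENNReal.ofReal (π.qe (fun s => D s ω) (s + lr))
            + (ENNReal.ofReal (newsvendorLoss h p S
                (∑ i ∈ Finset.range (lr + 1), D (s + i) ω))
              + ENNReal.ofReal (h * ∑ j ∈ Finset.range (lr - le),
                π.qe (fun s => D s ω) (s + 1 + j)))) ∂μ := by
          refine lintegral_mono_ae (hpos.mono fun ω hω => ?_)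
          have he : 0 ≤ ∑ j ∈ Finset.range (lr - le), π.qe (fun s => D s ω) (s + 1 + j) :=
            Finset.sum_nonneg fun _ _ => π.qe_nonneg _ _
          rw [π.periodCost_eq hl, hω s, ← ENNReal.ofReal_mul hce]
          refine ENNReal.ofReal_add_le.trans (add_le_add le_rfl ?_)
          exact (ENNReal.ofReal_le_ofReal (newsvendorLoss_add_le hh hp he _ _)).trans
            ENNReal.ofReal_add_le
      _ = ENNReal.ofReal ce * π.meanExpedited μ D (s + lr) + (newsvendorCost μ X h p S +
            ENNReal.ofReal h * ∑ j ∈ Finset.range (lr - le), π.meanExpedited μ D (s + 1 + j)) := by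
          rw [lintegral_add_left ((hqm _).ennreal_ofReal.const_mul _),
            lintegral_const_mul _ (hqm _).ennreal_ofReal,
            lintegral_add_left (measurable_newsvendorLoss measurable_const hW).ennreal_ofReal,
            hloss, π.lintegral_const_mul_sum_qe hD hh]
          rfl
      _ ≤ ENNReal.ofReal ce * ε + (newsvendorCost μ X h p S +
            ENNReal.ofReal h * ∑ j ∈ Finset.range (lr - le), ε) := by
          gcongr
          · exact hqe _
          · exact hqe _
      _ = _ := by
          rw [Finset.sum_const, Finset.card_range, nsmul_eq_mul]
          ring

end CostBounds

/-! ### Base-stock policies for a single supplier -/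

/-- The policy that raises the inventory position to `S` in period `0` and then replaces the
demand. -/
def SinglePolicy.baseStock (S : ℝ) (hS : 0 ≤ S) : SinglePolicy where
  order
    | 0, _ => S
    | t + 1, x => max (x (Fin.last t)) 0
  order_nonneg
    | 0, _ => hS
    | _ + 1, _ => le_max_right _ _
  measurable_order
    | 0 => measurable_const
    | t + 1 => (measurable_pi_apply (Fin.last t)).max measurable_const

theorem SinglePolicy.position_baseStock {S : ℝ} (hS : 0 ≤ S) {d : ℕ → ℝ} (hd : ∀ i, 0 ≤ d i)
    (t : ℕ) : (SinglePolicy.baseStock S hS).toPolicy.position d t = S := by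
  have hqr : ∀ t, (SinglePolicy.baseStock S hS).toPolicy.qr d (t + 1) = d t := fun t =>
    max_eq_left (hd t)
  induction t with
  | zero =>
    simp only [Policy.position, zero_add, Finset.sum_range_one, Finset.sum_range_zero, sub_zero,
      SinglePolicy.toPolicy_qe]
    rfl
  | succ t ih =>
    rw [Policy.position, Finset.sum_range_succ, Finset.sum_range_succ d, hqr,
      SinglePolicy.toPolicy_qe]
    rw [Policy.position] at ih
    linarith

theorem backlogOptimalCost_le_newsvendorValue {Ω : Type*} [MeasurableSpace Ω] {μ : Measure Ω}
    [IsProbabilityMeasure μ] {D : ℕ → Ω → ℝ} (hD : ∀ t, Measurable (D t))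
    (hD0 : ∀ t, ∀ᵐ ω ∂μ, 0 ≤ D t ω) (hind : iIndepFun D μ)
    (hid : ∀ t, IdentDistrib (D t) (D 0) μ μ) {L : ℕ} (hL : 0 < L)
    (hXi : Integrable (cumulativeDemand D (L + 1)) μ) {h p : ℝ} (hh : 0 ≤ h) (hp : 0 ≤ p) :
    backlogOptimalCost μ D L h p ≤ newsvendorValue μ (cumulativeDemand D (L + 1)) h p := by
  have hD0' : ∀ᵐ ω ∂μ, ∀ t, 0 ≤ D t ω := ae_all_iff.2 hD0
  have hX0 : ∀ᵐ ω ∂μ, 0 ≤ cumulativeDemand D (L + 1) ω := by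
    filter_upwards [hD0'] with ω hω using Finset.sum_nonneg fun _ _ => hω _
  have hbase : ∀ S, 0 ≤ S → backlogOptimalCost μ D L h p ≤
      newsvendorCost μ (cumulativeDemand D (L + 1)) h p S := by
    intro S hS
    refine (iInf_le _ (SinglePolicy.baseStock S hS)).trans ?_
    rw [← SinglePolicy.cost_toPolicy _ μ D 0 L h p 0]
    have := (SinglePolicy.baseStock S hS).toPolicy.cost_le_newsvendorCost hD hD0 hind hid hL hXi
      hh hp le_rfl hS (hD0'.mono fun ω hω t => SinglePolicy.position_baseStock hS hω t)
      ENNReal.zero_ne_top (fun t => by simp [Policy.meanExpedited, SinglePolicy.toPolicy_qe])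
    simpa using this
  refine le_iInf fun y => ?_
  rcases le_total 0 y with hy | hy
  · exact hbase y hy
  · exact (hbase 0 le_rfl).trans (newsvendorCost_zero_le hX0 hh hp hy)

/-! ### Index policies -/

/-- The expedited and the regular order of period `t` under the order-up-to rules with levels `Se`
and `Sr`, where the position that is compared with `Se` disregards the regular orders that are less
than `k` periods old. The choice `k = lr - le` gives the dual-index rule, and `k = 1` the
single-index rule. -/
def indexOrder (k : ℕ) (Se Sr : ℝ) (d : ℕ → ℝ) (t : ℕ) : ℝ × ℝ :=
  let e := max (Se - (∑ j : Fin t, (indexOrder k Se Sr d j).1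
    + ∑ j : Fin t, (if j + k ≤ t then (indexOrder k Se Sr d j).2 else 0)
    - ∑ i ∈ Finset.range t, d i)) 0
  (e, max (Sr - (∑ j : Fin t, ((indexOrder k Se Sr d j).1 + (indexOrder k Se Sr d j).2)
    - ∑ i ∈ Finset.range t, d i + e)) 0)
termination_by t
decreasing_by all_goals exact j.2

theorem indexOrder_congr (k : ℕ) (Se Sr : ℝ) {d d' : ℕ → ℝ} {t : ℕ} (hd : ∀ i < t, d i = d' i) :
    indexOrder k Se Sr d t = indexOrder k Se Sr d' t := by
  induction t using Nat.strong_induction_on with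
  | _ t ih =>
    have h1 : ∀ j : Fin t, indexOrder k Se Sr d j = indexOrder k Se Sr d' j := fun j =>
      ih j j.2 fun i hi => hd i (hi.trans j.2)
    have h2 : ∑ i ∈ Finset.range t, d i = ∑ i ∈ Finset.range t, d' i :=
      Finset.sum_congr rfl fun i hi => hd i (Finset.mem_range.1 hi)
    rw [indexOrder, indexOrder]
    simp only [h1, h2]

theorem measurable_indexOrder (k : ℕ) (Se Sr : ℝ) (t : ℕ) :
    Measurable fun d => indexOrder k Se Sr d t := by
  induction t using Nat.strong_induction_on with
  | _ t ih =>
    have h1 : ∀ j : Fin t, Measurable fun d => (indexOrder k Se Sr d j).1 := fun j =>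
      (ih j j.2).fst
    have h2 : ∀ j : Fin t, Measurable fun d => (indexOrder k Se Sr d j).2 := fun j =>
      (ih j j.2).snd
    have h3 : Measurable fun d : ℕ → ℝ => ∑ i ∈ Finset.range t, d i :=
      Finset.measurable_sum _ fun i _ => measurable_pi_apply i
    have h4 : Measurable fun d : ℕ → ℝ => ∑ j : Fin t,
        (if j + k ≤ t then (indexOrder k Se Sr d j).2 else 0) :=
      Finset.measurable_sum _ fun j _ => by
        split_ifs
        · exact h2 j
        · exact measurable_const
    have h5 : Measurable fun d => (indexOrder k Se Sr d t).1 := by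
      simp_rw [indexOrder.eq_1 k Se Sr _ t]
      exact (measurable_const.sub (((Finset.measurable_sum _ fun j _ => h1 j).add h4).sub
        h3)).max measurable_const
    refine h5.prodMk (f := fun d => (indexOrder k Se Sr d t).1)
      (g := fun d => (indexOrder k Se Sr d t).2) ?_
    have h6 : ∀ d, (indexOrder k Se Sr d t).2 =
        max (Sr - (∑ j : Fin t, ((indexOrder k Se Sr d j).1 + (indexOrder k Se Sr d j).2)
          - ∑ i ∈ Finset.range t, d i + (indexOrder k Se Sr d t).1)) 0 := fun d => by
      simp_rw [indexOrder.eq_1 k Se Sr _ t]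
    simp_rw [h6]
    exact (measurable_const.sub (((Finset.measurable_sum _ fun j _ => (h1 j).add (h2 j)).sub
      h3).add h5)).max measurable_const

/-- A finite demand history, continued by zeros. -/
def extendHistory {t : ℕ} (x : Fin t → ℝ) (i : ℕ) : ℝ := if hi : i < t then x ⟨i, hi⟩ else 0

theorem measurable_extendHistory (t : ℕ) : Measurable (extendHistory (t := t)) := by
  refine measurable_pi_lambda _ fun i => ?_
  by_cases hi : i < t
  · simpa only [extendHistory, hi, dif_pos] using measurable_pi_apply _
  · simpa only [extendHistory, hi, dif_neg, not_false_eq_true] using measurable_const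

/-- The admissible policy with the orders `indexOrder`. -/
def indexPolicy (k : ℕ) (Se Sr : ℝ) : Policy where
  expedited t x := (indexOrder k Se Sr (extendHistory x) t).1
  regular t x := (indexOrder k Se Sr (extendHistory x) t).2
  expedited_nonneg t x := by rw [indexOrder]; exact le_max_right _ _
  regular_nonneg t x := by rw [indexOrder]; exact le_max_right _ _
  measurable_expedited t :=
    ((measurable_indexOrder k Se Sr t).comp (measurable_extendHistory t)).fst
  measurable_regular t :=
    ((measurable_indexOrder k Se Sr t).comp (measurable_extendHistory t)).snd

theorem indexOrder_extendHistory (k : ℕ) (Se Sr : ℝ) (d : ℕ → ℝ) (t : ℕ) :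
    indexOrder k Se Sr (extendHistory fun i : Fin t => d i) t = indexOrder k Se Sr d t :=
  indexOrder_congr k Se Sr fun i hi => by simp [extendHistory, hi]

theorem indexPolicy_qe_eq_indexOrder (k : ℕ) (Se Sr : ℝ) (d : ℕ → ℝ) (t : ℕ) :
    (indexPolicy k Se Sr).qe d t = (indexOrder k Se Sr d t).1 :=
  congrArg Prod.fst (indexOrder_extendHistory k Se Sr d t)

theorem indexPolicy_qr_eq_indexOrder (k : ℕ) (Se Sr : ℝ) (d : ℕ → ℝ) (t : ℕ) :
    (indexPolicy k Se Sr).qr d t = (indexOrder k Se Sr d t).2 :=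
  congrArg Prod.snd (indexOrder_extendHistory k Se Sr d t)

theorem indexPolicy_qe {k : ℕ} (hk : 1 ≤ k) (Se Sr : ℝ) (d : ℕ → ℝ) (t : ℕ) :
    (indexPolicy k Se Sr).qe d t =
      max (Se - (∑ j ∈ Finset.range t, (indexPolicy k Se Sr).qe d j
        + ∑ j ∈ Finset.range (t + 1 - k), (indexPolicy k Se Sr).qr d j
        - ∑ i ∈ Finset.range t, d i)) 0 := by
  have hr : Finset.range (t + 1 - k) = (Finset.range t).filter fun j => j + k ≤ t := by
    ext j; simp; omega
  rw [hr, Finset.sum_filter]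
  simp_rw [indexPolicy_qe_eq_indexOrder, indexPolicy_qr_eq_indexOrder]
  rw [Finset.sum_range, Finset.sum_range, indexOrder]

theorem indexPolicy_qr (k : ℕ) (Se Sr : ℝ) (d : ℕ → ℝ) (t : ℕ) :
    (indexPolicy k Se Sr).qr d t =
      max (Sr - (∑ j ∈ Finset.range t,
          ((indexPolicy k Se Sr).qe d j + (indexPolicy k Se Sr).qr d j)
        - ∑ i ∈ Finset.range t, d i + (indexPolicy k Se Sr).qe d t)) 0 := by
  simp_rw [indexPolicy_qe_eq_indexOrder, indexPolicy_qr_eq_indexOrder]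
  rw [Finset.sum_range, indexOrder]

theorem indexPolicy_mem_dualIndex {le lr : ℕ} (hl : le < lr) (Se Sr : ℝ) :
    indexPolicy (lr - le) Se Sr ∈ dualIndex le lr := by
  refine ⟨Se, Sr, fun d t => ?_⟩
  rw [Policy.expeditedPosition_eq _ hl, Policy.regularPosition_eq _ hl]
  exact ⟨indexPolicy_qe (by omega) Se Sr d t, indexPolicy_qr _ Se Sr d t⟩

theorem indexPolicy_mem_singleIndex {le lr : ℕ} (hl : le < lr) (Se Sr : ℝ) :
    indexPolicy 1 Se Sr ∈ singleIndex le lr := by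
  refine ⟨Se, Sr, fun d t => ?_⟩
  rw [Policy.regularPosition_eq _ hl]
  refine ⟨?_, indexPolicy_qr _ Se Sr d t⟩
  rw [indexPolicy_qe le_rfl, Nat.add_sub_cancel, Finset.sum_add_distrib]

/-- A dual-index policy is a capped dual-index policy with an infinite cap. -/
theorem dualIndex_subset_cappedDualIndex (le lr : ℕ) : dualIndex le lr ⊆ cappedDualIndex le lr := by
  rintro π ⟨Se, Sr, hπ⟩
  refine ⟨Se, Sr, ⊤, fun d t => ⟨(hπ d t).1, ?_⟩⟩
  rw [(hπ d t).2, min_eq_left le_top, ENNReal.ofReal_max, ENNReal.ofReal_zero, max_eq_left zero_le]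

/-- With `Se ≤ 0 ≤ Sr` an index policy keeps the inventory position at `Sr`: the expedited position
never falls below `Se` after ordering, so an expedited order is at most the last demand. -/
theorem position_indexPolicy {k : ℕ} (hk : 1 ≤ k) {Se Sr : ℝ} (hSe : Se ≤ 0) (hSr : 0 ≤ Sr)
    {d : ℕ → ℝ} (hd : ∀ i, 0 ≤ d i) (t : ℕ) : (indexPolicy k Se Sr).position d t = Sr := by
  set π := indexPolicy k Se Sr with hπ
  have hqe := indexPolicy_qe hk Se Sr d
  have hqr := indexPolicy_qr k Se Sr d
  rw [← hπ] at hqe hqr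
  induction t with
  | zero =>
    have h0 : 0 + 1 - k = 0 := by omega
    have h1 := hqe 0
    have h2 := hqr 0
    simp only [h0, Finset.sum_range_zero, add_zero, sub_zero, zero_add] at h1 h2
    rw [max_eq_right hSe] at h1
    rw [h1, sub_zero, max_eq_left hSr] at h2
    simp [Policy.position, h1, h2]
  | succ t ih =>
    have hle : π.qe d (t + 1) ≤ d t := by
      rw [hqe (t + 1)]
      refine max_le ?_ (hd t)
      have h1 : Se - (∑ j ∈ Finset.range t, π.qe d j + ∑ j ∈ Finset.range (t + 1 - k), π.qr d j
          - ∑ i ∈ Finset.range t, d i) ≤ π.qe d t := by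
        rw [hqe t]; exact le_max_left _ _
      have h2 : ∑ j ∈ Finset.range (t + 1 - k), π.qr d j ≤
          ∑ j ∈ Finset.range (t + 1 + 1 - k), π.qr d j :=
        Finset.sum_le_sum_of_subset_of_nonneg (Finset.range_mono (by omega))
          fun _ _ _ => π.qr_nonneg _ _
      rw [Finset.sum_range_succ, Finset.sum_range_succ d]
      linarith
    have h3 := hqr (t + 1)
    have h4 : ∑ j ∈ Finset.range (t + 1), (π.qe d j + π.qr d j) - ∑ i ∈ Finset.range (t + 1), d i
        = Sr - d t := by
      rw [Finset.sum_range_succ d, ← ih, Policy.position]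
      ring
    rw [h4] at h3
    rw [max_eq_left (by linarith)] at h3
    rw [Policy.position, Finset.sum_range_succ, h3]
    linarith

/-- The expedited orders of an index policy with `Se ≤ 0 ≤ Sr` are at most the excess over `-Se` of
the demand of the last `k` periods, since the inventory position `k` periods ago was `Sr`. -/
theorem qe_indexPolicy_le {k : ℕ} (hk : 1 ≤ k) {Se Sr : ℝ} (hSe : Se ≤ 0) (hSr : 0 ≤ Sr)
    {d : ℕ → ℝ} (hd : ∀ i, 0 ≤ d i) (t : ℕ) :
    (indexPolicy k Se Sr).qe d t ≤ max (∑ i ∈ Finset.range k, d (t - k + i) + Se) 0 := by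
  set π := indexPolicy k Se Sr with hπ
  have hqe := indexPolicy_qe hk Se Sr d t
  rw [← hπ] at hqe
  rw [hqe]
  refine max_le_max ?_ le_rfl
  rcases lt_or_ge t k with htk | hkt
  · have h0 : t + 1 - k = 0 := by omega
    have h1 : ∑ i ∈ Finset.range t, d i ≤ ∑ i ∈ Finset.range k, d (t - k + i) := by
      rw [Nat.sub_eq_zero_of_le htk.le]
      simp only [zero_add]
      exact Finset.sum_le_sum_of_subset_of_nonneg (Finset.range_mono htk.le) fun _ _ _ => hd _
    have h2 : 0 ≤ ∑ j ∈ Finset.range t, π.qe d j := Finset.sum_nonneg fun _ _ => π.qe_nonneg _ _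
    rw [h0, Finset.sum_range_zero]
    linarith
  · obtain ⟨s, rfl⟩ : ∃ s, t = s + k := ⟨t - k, by omega⟩
    have h1 := position_indexPolicy hk hSe hSr hd s
    rw [← hπ, Policy.position, Finset.sum_add_distrib] at h1
    have h2 : ∑ j ∈ Finset.range (s + 1), π.qe d j ≤ ∑ j ∈ Finset.range (s + k), π.qe d j :=
      Finset.sum_le_sum_of_subset_of_nonneg (Finset.range_mono (by omega))
        fun _ _ _ => π.qe_nonneg _ _
    rw [show s + k + 1 - k = s + 1 by omega, Nat.add_sub_cancel,
      Finset.sum_range_add (fun i => d i)]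
    linarith

section Expedited

variable {Ω : Type*} [MeasurableSpace Ω] {μ : Measure Ω} {D : ℕ → Ω → ℝ}

theorem meanExpedited_indexPolicy_le (hD0 : ∀ t, ∀ᵐ ω ∂μ, 0 ≤ D t ω) (hind : iIndepFun D μ)
    (hid : ∀ t, IdentDistrib (D t) (D 0) μ μ) {k n : ℕ} (hk : 1 ≤ k) (hkn : k ≤ n) {Se Sr : ℝ}
    (hSe : Se ≤ 0) (hSr : 0 ≤ Sr) (t : ℕ) :
    (indexPolicy k Se Sr).meanExpedited μ D t ≤
      ∫⁻ ω, ENNReal.ofReal (cumulativeDemand D n ω + Se) ∂μ := by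
  have hD0' : ∀ᵐ ω ∂μ, ∀ t, 0 ≤ D t ω := ae_all_iff.2 hD0
  calc (indexPolicy k Se Sr).meanExpedited μ D t
      ≤ ∫⁻ ω, ENNReal.ofReal (∑ i ∈ Finset.range k, D (t - k + i) ω + Se) ∂μ := by
        refine lintegral_mono_ae (hD0'.mono fun ω hω => ?_)
        refine (ENNReal.ofReal_le_ofReal (qe_indexPolicy_le hk hSe hSr hω t)).trans (le_of_eq ?_)
        rw [ENNReal.ofReal_max, ENNReal.ofReal_zero, max_eq_left zero_le]
    _ = ∫⁻ ω, ENNReal.ofReal (cumulativeDemand D k ω + Se) ∂μ :=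
        ((identDistrib_windowDemand hind hid (t - k) k).comp
          (measurable_id.add_const Se).ennreal_ofReal).lintegral_eq
    _ ≤ ∫⁻ ω, ENNReal.ofReal (cumulativeDemand D n ω + Se) ∂μ := by
        refine lintegral_mono_ae (hD0'.mono fun ω hω => ?_)
        have : cumulativeDemand D k ω ≤ cumulativeDemand D n ω :=
          Finset.sum_le_sum_of_subset_of_nonneg (Finset.range_mono hkn) fun _ _ _ => hω _
        exact ENNReal.ofReal_le_ofReal (by linarith)

theorem tendsto_lintegral_excess {X : Ω → ℝ} (hX : Measurable X) (hXi : Integrable X μ) :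
    Tendsto (fun m : ℕ => ∫⁻ ω, ENNReal.ofReal (X ω + -(m : ℝ)) ∂μ) atTop (𝓝 0) := by
  have h := tendsto_lintegral_of_dominated_convergence (μ := μ)
    (F := fun (m : ℕ) ω => ENNReal.ofReal (X ω + -(m : ℝ))) (f := fun _ => 0)
    (fun ω => ENNReal.ofReal (X ω)) (fun m => (hX.add_const _).ennreal_ofReal)
    (fun m => ae_of_all _ fun ω => ENNReal.ofReal_le_ofReal (by
      have : (0 : ℝ) ≤ m := Nat.cast_nonneg m
      linarith)) hXi.lintegral_lt_top.ne
    (ae_of_all _ fun ω => by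
      obtain ⟨N, hN⟩ := exists_nat_ge (X ω)
      refine tendsto_const_nhds.congr' ?_
      filter_upwards [eventually_ge_atTop N] with m hm
      have : (N : ℝ) ≤ m := by exact_mod_cast hm
      exact (ENNReal.ofReal_of_nonpos (by linarith)).symm)
  simpa using h

/-- A class that contains the index policies of one kind attains the newsvendor value: as
`Se → -∞` the expedited orders vanish, at an inventory position that stays at the optimal stock. -/
theorem bestCost_le_newsvendorValue [IsProbabilityMeasure μ] (hD : ∀ t, Measurable (D t))
    (hD0 : ∀ t, ∀ᵐ ω ∂μ, 0 ≤ D t ω) (hind : iIndepFun D μ)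
    (hid : ∀ t, IdentDistrib (D t) (D 0) μ μ) {le lr : ℕ} (hl : le < lr)
    (hXi : Integrable (cumulativeDemand D (lr + 1)) μ) {h p ce : ℝ} (hh : 0 ≤ h) (hp : 0 ≤ p)
    (hce : 0 ≤ ce) {P : Set Policy} {k : ℕ} (hk : 1 ≤ k) (hkl : k ≤ lr + 1)
    (hP : ∀ Se Sr, indexPolicy k Se Sr ∈ P) :
    bestCost P μ D le lr h p ce ≤ newsvendorValue μ (cumulativeDemand D (lr + 1)) h p := by
  have hD0' : ∀ᵐ ω ∂μ, ∀ t, 0 ≤ D t ω := ae_all_iff.2 hD0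
  set X := cumulativeDemand D (lr + 1) with hX
  have hXm : Measurable X := measurable_cumulativeDemand hD _
  have hX0 : ∀ᵐ ω ∂μ, 0 ≤ X ω := by
    filter_upwards [hD0'] with ω hω using Finset.sum_nonneg fun _ _ => hω _
  have hS : ∀ S, 0 ≤ S → bestCost P μ D le lr h p ce ≤ newsvendorCost μ X h p S := by
    intro S hS
    have hlim : Tendsto (fun m : ℕ => newsvendorCost μ X h p S
        + (ENNReal.ofReal ce + ENNReal.ofReal h * (lr - le : ℕ)) *
          ∫⁻ ω, ENNReal.ofReal (X ω + -(m : ℝ)) ∂μ) atTop (𝓝 (newsvendorCost μ X h p S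
        + (ENNReal.ofReal ce + ENNReal.ofReal h * (lr - le : ℕ)) * 0)) :=
      tendsto_const_nhds.add (ENNReal.Tendsto.const_mul (tendsto_lintegral_excess hXm hXi)
        (Or.inr (ENNReal.add_ne_top.2 ⟨ENNReal.ofReal_ne_top,
          ENNReal.mul_ne_top ENNReal.ofReal_ne_top (ENNReal.natCast_ne_top _)⟩)))
    rw [mul_zero, add_zero] at hlim
    refine ge_of_tendsto' hlim fun m => ?_
    have hm : -(m : ℝ) ≤ 0 := neg_nonpos.2 (Nat.cast_nonneg m)
    refine (iInf₂_le _ (hP (-(m : ℝ)) S)).trans ?_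
    exact (indexPolicy k (-(m : ℝ)) S).cost_le_newsvendorCost hD hD0 hind hid hl hXi hh hp hce hS
      (hD0'.mono fun ω hω t => position_indexPolicy hk hm hS hω t)
      ((hXi.add (integrable_const _)).lintegral_lt_top).ne
      fun t => meanExpedited_indexPolicy_le hD0 hind hid hk hkl hm hS t
  refine le_iInf fun y => ?_
  rcases le_total 0 y with hy | hy
  · exact hS y hy
  · exact (hS 0 le_rfl).trans (newsvendorCost_zero_le hX0 hh hp hy)

end Expedited

/-! ### Asymptotic optimality -/

/-- A sum of independent copies of a nonnegative random variable that is not almost surely constant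
is not almost surely constant: otherwise its summands are bounded, and their variances add up
to `0`. -/
theorem not_ae_const_cumulativeDemand {Ω : Type*} [MeasurableSpace Ω] {μ : Measure Ω}
    [IsProbabilityMeasure μ] {D : ℕ → Ω → ℝ} (hD : ∀ t, Measurable (D t))
    (hD0 : ∀ t, ∀ᵐ ω ∂μ, 0 ≤ D t ω) (hind : iIndepFun D μ)
    (hrandom : ¬ ∃ a : ℝ, ∀ᵐ ω ∂μ, D 0 ω = a) (n : ℕ) (m : ℝ) :
    ¬ ∀ᵐ ω ∂μ, cumulativeDemand D (n + 1) ω = m := by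
  intro hconst
  have hD0' : ∀ᵐ ω ∂μ, ∀ t, 0 ≤ D t ω := ae_all_iff.2 hD0
  have hmem : ∀ i ∈ Finset.range (n + 1), MemLp (D i) 2 μ := by
    intro i hi
    refine MemLp.of_bound (hD i).aestronglyMeasurable m ?_
    filter_upwards [hconst, hD0'] with ω hω hdω
    rw [Real.norm_of_nonneg (hdω i), ← hω]
    exact Finset.single_le_sum (f := fun j => D j ω) (fun j _ => hdω j) hi
  have hvar := IndepFun.variance_sum hmem fun i _ j _ hij => hind.indepFun hij
  have hzero : Var[∑ i ∈ Finset.range (n + 1), D i; μ] = 0 := by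
    have : (∑ i ∈ Finset.range (n + 1), D i) =ᵐ[μ] fun _ => m := by
      filter_upwards [hconst] with ω hω
      rw [Finset.sum_apply]
      exact hω
    rw [variance_congr this, variance_eq_integral aemeasurable_const]
    simp
  rw [hzero] at hvar
  have h0 : Var[D 0; μ] = 0 :=
    (Finset.sum_eq_zero_iff_of_nonneg fun i _ => variance_nonneg (D i) μ).1 hvar.symm 0 (by simp)
  exact hrandom ⟨_, ae_eq_integral_of_variance_eq_zero (hmem 0 (by simp)) h0⟩

/-- If `V` and `W` enclose both the numerator and the denominator, and `W` is eventually at most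
`(1 + ε) * V` for each `ε > 0`, then the ratio tends to `1`. -/
theorem tendsto_div_one {f g V W : ℝ → ℝ≥0∞} (hgpos : ∀ n, 0 < n → 0 < g n)
    (hgtop : ∀ n, 0 < n → g n < ⊤) (hgf : ∀ n, 0 < n → g n ≤ f n) (hVg : ∀ n, 0 < n → V n ≤ g n)
    (hfW : ∀ n, 0 < n → f n ≤ W n)
    (hWV : ∀ ε : ℝ, 0 < ε → ∀ᶠ n in atTop, W n ≤ ENNReal.ofReal (1 + ε) * V n) :
    Tendsto (fun n => f n / g n) atTop (𝓝 1) := by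
  refine tendsto_order.2 ⟨fun a ha => ?_, fun a ha => ?_⟩
  · filter_upwards [eventually_gt_atTop 0] with n hn
    refine ha.trans_le ?_
    rw [ENNReal.le_div_iff_mul_le (Or.inl (hgpos n hn).ne') (Or.inl (hgtop n hn).ne), one_mul]
    exact hgf n hn
  · obtain ⟨r, hr1, hra⟩ := ENNReal.lt_iff_exists_nnreal_btwn.1 ha
    have hr : (1 : ℝ) < r := by exact_mod_cast hr1
    filter_upwards [eventually_gt_atTop 0, hWV (r - 1) (by linarith)] with n hn hWn
    refine lt_of_le_of_lt ?_ hra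
    rw [add_sub_cancel, ENNReal.ofReal_coe_nnreal] at hWn
    rw [ENNReal.div_le_iff_le_mul (Or.inl (hgpos n hn).ne') (Or.inl (hgtop n hn).ne)]
    exact (hfW n hn).trans (hWn.trans (by gcongr; exact hVg n hn))

end DualSourcing

end

theorem theorem2 {Ω : Type*} [MeasurableSpace Ω] (μ : Measure Ω) [IsProbabilityMeasure μ]
    (D : ℕ → Ω → ℝ) (hD_meas : ∀ t, Measurable (D t)) (hD_nonneg : ∀ t, ∀ᵐ ω ∂μ, 0 ≤ D t ω)
    (hD_indep : iIndepFun D μ) (hD_ident : ∀ t, IdentDistrib (D t) (D 0) μ μ)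
    (hD_random : ¬ ∃ a : ℝ, ∀ᵐ ω ∂μ, D 0 ω = a)
    (le lr : ℕ) (hl : le < lr) (h p ce : ℝ) (hh : 0 < h) (hp : 0 < p) (hce : 0 < ce)
    (hratio : ce / p < (lr : ℝ) - (le : ℝ))
    (hD_tail : DualSourcing.TailAssumption μ (DualSourcing.cumulativeDemand D (lr + 1))) :
    -- the optimal cost is positive and finite, so that the ratios below are genuine
    (∀ n : ℝ, 0 < n → 0 < DualSourcing.optimalCost μ D le lr h (p * n) (ce * n) ∧
      DualSourcing.optimalCost μ D le lr h (p * n) (ce * n) < ⊤) ∧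
    -- policies that do no worse than optimal single sourcing
    (∀ π : ℝ → DualSourcing.Policy,
      (∀ n : ℝ, 0 < n →
        π n ∈ DualSourcing.noWorseThanSingleSourcing μ D le lr h (p * n) (ce * n)) →
      Tendsto (fun n : ℝ => (π n).cost μ D le lr h (p * n) (ce * n) /
        DualSourcing.optimalCost μ D le lr h (p * n) (ce * n)) atTop (𝓝 1)) ∧
    -- classes of policies whose best cost does no worse than optimal single sourcing
    (∀ P : Set DualSourcing.Policy,
      (∀ n : ℝ, 0 < n → DualSourcing.bestCost P μ D le lr h (p * n) (ce * n) ≤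
        DualSourcing.backlogOptimalCost μ D lr h (p * n)) →
      Tendsto (fun n : ℝ => DualSourcing.bestCost P μ D le lr h (p * n) (ce * n) /
        DualSourcing.optimalCost μ D le lr h (p * n) (ce * n)) atTop (𝓝 1)) ∧
    -- the capped dual-index, dual-index and single-index policies
    (∀ P ∈ ({DualSourcing.cappedDualIndex le lr, DualSourcing.dualIndex le lr,
        DualSourcing.singleIndex le lr} : Set (Set DualSourcing.Policy)),
      (∀ n : ℝ, 0 < n → DualSourcing.bestCost P μ D le lr h (p * n) (ce * n) ≤
        DualSourcing.backlogOptimalCost μ D lr h (p * n)) ∧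
      Tendsto (fun n : ℝ => DualSourcing.bestCost P μ D le lr h (p * n) (ce * n) /
        DualSourcing.optimalCost μ D le lr h (p * n) (ce * n)) atTop (𝓝 1)) := by
  have hD0' : ∀ᵐ ω ∂μ, ∀ t, 0 ≤ D t ω := ae_all_iff.2 hD_nonneg
  set X := DualSourcing.cumulativeDemand D (lr + 1) with hX
  have hXm : Measurable X := DualSourcing.measurable_cumulativeDemand hD_meas _
  have hXi : Integrable X μ := hD_tail.1.1
  have hX0 : ∀ᵐ ω ∂μ, 0 ≤ X ω := by
    filter_upwards [hD0'] with ω hω using Finset.sum_nonneg fun _ _ => hω _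
  have hlr : 0 < lr := by omega
  have hVpos : ∀ q, 0 < q → 0 < DualSourcing.newsvendorValue μ X h q := fun q hq =>
    DualSourcing.newsvendorValue_pos hXi hh hq
      (DualSourcing.not_ae_const_cumulativeDemand hD_meas hD_nonneg hD_indep hD_random lr _)
  -- the shortage cost `c` for which the expedited premium pays in each of the `lr - le` periods
  have hl0 : (0 : ℝ) < (lr - le : ℕ) := by exact_mod_cast Nat.sub_pos_of_lt hl
  set c : ℝ := ce / (lr - le : ℕ) with hc
  have hc0 : 0 < c := by positivity
  have hcp : c < p := by
    rw [hc, div_lt_iff₀ hl0, Nat.cast_sub hl.le, mul_comm]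
    exact (div_lt_iff₀ hp).1 hratio
  have hcl : (lr - le : ℕ) * c = ce := by rw [hc]; field_simp
  have hlow : ∀ n : ℝ, 0 < n → DualSourcing.newsvendorValue μ X h (c * n) ≤
      DualSourcing.optimalCost μ D le lr h (p * n) (ce * n) := fun n hn =>
    le_iInf fun π => π.newsvendorValue_le_cost hD_meas hD_indep hD_ident hl hh.le (by positivity)
      (by gcongr) (by rw [← mul_assoc, hcl])
  have hback : ∀ n : ℝ, 0 < n → DualSourcing.backlogOptimalCost μ D lr h (p * n) ≤
      DualSourcing.newsvendorValue μ X h (p * n) := fun n hn =>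
    DualSourcing.backlogOptimalCost_le_newsvendorValue hD_meas hD_nonneg hD_indep hD_ident hlr hXi
      hh.le (by positivity)
  have hback' : ∀ n : ℝ, 0 < n → DualSourcing.newsvendorValue μ X h (p * n) ≤
      DualSourcing.backlogOptimalCost μ D lr h (p * n) := fun n hn =>
    DualSourcing.newsvendorValue_le_backlogOptimalCost hD_meas hD_indep hD_ident hlr hh.le
      (by positivity)
  have hindex : ∀ {P : Set DualSourcing.Policy} {k : ℕ}, 1 ≤ k → k ≤ lr + 1 →
      (∀ Se Sr, DualSourcing.indexPolicy k Se Sr ∈ P) → ∀ n : ℝ, 0 < n →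
      DualSourcing.bestCost P μ D le lr h (p * n) (ce * n) ≤
        DualSourcing.newsvendorValue μ X h (p * n) := fun hk hkl hP n hn =>
    DualSourcing.bestCost_le_newsvendorValue hD_meas hD_nonneg hD_indep hD_ident hl hXi hh.le
      (by positivity) (by positivity) hk hkl hP
  have hopt : ∀ (P : Set DualSourcing.Policy) (n : ℝ),
      DualSourcing.optimalCost μ D le lr h (p * n) (ce * n) ≤
        DualSourcing.bestCost P μ D le lr h (p * n) (ce * n) := fun P n =>
    le_iInf₂ fun π _ => iInf_le _ π
  have hdual := hindex (k := lr - le) (by omega) (by omega)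
    fun Se Sr => DualSourcing.indexPolicy_mem_dualIndex hl Se Sr
  have hoptpos : ∀ n : ℝ, 0 < n → 0 < DualSourcing.optimalCost μ D le lr h (p * n) (ce * n) :=
    fun n hn => (hVpos _ (by positivity)).trans_le (hlow n hn)
  have hopttop : ∀ n : ℝ, 0 < n → DualSourcing.optimalCost μ D le lr h (p * n) (ce * n) < ⊤ :=
    fun n hn => ((hopt _ n).trans (hdual n hn)).trans_lt
      (DualSourcing.newsvendorValue_lt_top hXi hh.le (by positivity))
  have hratio_tendsto : ∀ f : ℝ → ℝ≥0∞,
      (∀ n, 0 < n → DualSourcing.optimalCost μ D le lr h (p * n) (ce * n) ≤ f n) →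
      (∀ n, 0 < n → f n ≤ DualSourcing.backlogOptimalCost μ D lr h (p * n)) →
      Tendsto (fun n => f n / DualSourcing.optimalCost μ D le lr h (p * n) (ce * n)) atTop (𝓝 1) :=
    fun f hf1 hf2 => DualSourcing.tendsto_div_one hoptpos hopttop hf1 hlow
      (fun n hn => (hf2 n hn).trans (hback n hn))
      fun ε hε => DualSourcing.newsvendorValue_eventually_le hXm hX0 hh (hVpos 1 one_pos) hD_tail
        hc0 hcp hε
  have hclass : ∀ P : Set DualSourcing.Policy,
      (∀ n : ℝ, 0 < n → DualSourcing.bestCost P μ D le lr h (p * n) (ce * n) ≤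
        DualSourcing.backlogOptimalCost μ D lr h (p * n)) →
      Tendsto (fun n : ℝ => DualSourcing.bestCost P μ D le lr h (p * n) (ce * n) /
        DualSourcing.optimalCost μ D le lr h (p * n) (ce * n)) atTop (𝓝 1) := fun P hP =>
    hratio_tendsto _ (fun n _ => hopt P n) hP
  refine ⟨fun n hn => ⟨hoptpos n hn, hopttop n hn⟩, fun π hπ => ?_, hclass, fun P hP => ?_⟩
  · exact hratio_tendsto _ (fun n _ => iInf_le _ (π n)) hπ
  · have hbest : ∀ n : ℝ, 0 < n → DualSourcing.bestCost P μ D le lr h (p * n) (ce * n) ≤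
        DualSourcing.backlogOptimalCost μ D lr h (p * n) := by
      intro n hn
      refine le_trans ?_ (hback' n hn)
      rcases hP with rfl | rfl | rfl
      · exact (iInf_le_iInf_of_subset (DualSourcing.dualIndex_subset_cappedDualIndex le lr)).trans
          (hdual n hn)
      · exact hdual n hn
      · exact hindex le_rfl (by omega)
          (fun Se Sr => DualSourcing.indexPolicy_mem_singleIndex hl Se Sr) n hn
    exact ⟨hbest, hclass P hbest⟩
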